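/- Fix an integer $n\ge 1$. A polynomial $f\in\mathbb C[z_1,\dots,z_n]$ is called real stable if all its coefficients are real and $f(z_1,\dots,z_n)\ne 0$ whenever $\operatorname{Im} z_j>0$ for all $j$. A finite order linear differential operator with polynomial coefficients, $T=\sum_{\alpha,\beta\in\mathbb N^n}a_{\alpha\beta}z^\alpha\partial^\beta$ (a finite sum with $a_{\alpha\beta}\in\mathbb C$), acting on $\mathbb C[z_1,\dots,z_n]$, has the symbol $F_T(z,w)=\sum_{\alpha,\beta}a_{\alpha\beta}z^\alpha w^\beta\in\mathbb C[z_1,\dots,z_n,w_1,\dots,w_n]$. Let $\mathcal A_n(\mathbb R)$ be the set of all nonzero such operators $T$ with all $a_{\alpha\beta}\in\mathbb R$ that map every real stable polynomial to a polynomial that is either real stable or identically zero. **Theorem 1.8.** Let $\lambda:\mathbb N^n\to\mathbb R$ be a map and let $T$ be the corresponding diagonal linear operator on $\mathbb C[z_1,\dots,z_n]$, given by $T(z^\alpha)=\lambda(\alpha)z^\alpha$ for all $\alpha\in\mathbb N^n$. Then $T\in\mathcal A_n(\mathbb R)$ if and only if $T$ is a finite order linear differential operator with polynomial coefficients whose symbol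 has the form $$F_T(z,w)=f_1(z_1w_1)f_2(z_2w_2)\cdots f_n(z_nw_n),$$ where each $f_i\in\mathbb R[t]$, $1\le i\le n$, is a nonzero polynomial all of whose complex zeros are real and nonpositive (nonzero constants are allowed). -/

import Mathlib

noncomputable section

/-- A polynomial all of whose coefficients are real. -/
def HasRealCoeffs {σ : Type*} (f : MvPolynomial σ ℂ) : Prop :=
  ∀ m : σ →₀ ℕ, (f.coeff m).im = 0

/-- `f` is stable: it has no zero at which every coordinate has positive imaginary part. -/
def IsStable {n : ℕ} (f : MvPolynomial (Fin n) ℂ) : Prop :=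
  ∀ z : Fin n → ℂ, (∀ j, 0 < (z j).im) → MvPolynomial.eval z f ≠ 0

/-- `f` is real stable: stable, with real coefficients. -/
def IsRealStable {n : ℕ} (f : MvPolynomial (Fin n) ℂ) : Prop :=
  IsStable f ∧ HasRealCoeffs f

/-- The linear operators on `ℂ[z₁, …, zₙ]`. -/
abbrev PolyOp (n : ℕ) : Type := Module.End ℂ (MvPolynomial (Fin n) ℂ)

/-- The operator of multiplication by `z^α = z₁^α₁ ⋯ zₙ^αₙ`. -/
def mulMonomialOp {n : ℕ} (α : Fin n → ℕ) : PolyOp n :=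
  LinearMap.mulLeft ℂ (∏ i, (MvPolynomial.X i : MvPolynomial (Fin n) ℂ) ^ α i)

/-- The operator `∂^β = ∂₁^β₁ ⋯ ∂ₙ^βₙ`; the product in `PolyOp n` is composition. -/
def partialOp {n : ℕ} (β : Fin n → ℕ) : PolyOp n :=
  (List.ofFn fun i : Fin n =>
    (((MvPolynomial.pderiv i : Derivation ℂ (MvPolynomial (Fin n) ℂ) (MvPolynomial (Fin n) ℂ)) :
      MvPolynomial (Fin n) ℂ →ₗ[ℂ] MvPolynomial (Fin n) ℂ) : PolyOp n) ^ β i).prod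

/-- The finite order differential operator `∑ a_{αβ} z^α ∂^β` that is attached to the polynomial
`F(z, w) = ∑ a_{αβ} z^α w^β`; the variable `zᵢ` is `X (Sum.inl i)` and `wᵢ` is `X (Sum.inr i)`. -/
def diffOp {n : ℕ} (F : MvPolynomial (Fin n ⊕ Fin n) ℂ) : PolyOp n :=
  ∑ m ∈ F.support, F.coeff m •
    (mulMonomialOp (fun i => m (Sum.inl i)) * partialOp (fun i => m (Sum.inr i)))

/-- `T` is a finite order differential operator with polynomial coefficients, and `F` is its
symbol. -/
def HasSymbol {n : ℕ} (T : PolyOp n) (F : MvPolynomial (Fin n ⊕ Fin n) ℂ) : Prop :=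
  T = diffOp F

/-- `T` belongs to the real Weyl algebra: it is a finite order linear differential operator with
real polynomial coefficients. -/
def IsRealDiffOp {n : ℕ} (T : PolyOp n) : Prop :=
  ∃ F : MvPolynomial (Fin n ⊕ Fin n) ℂ, HasRealCoeffs F ∧ HasSymbol T F

/-- `T` is a finite order real stability preserver: a nonzero operator in the real Weyl algebra
that sends every real stable polynomial to a real stable polynomial or to `0`. -/
def IsFiniteOrderRealStabilityPreserver {n : ℕ} (T : PolyOp n) : Prop :=
  IsRealDiffOp T ∧ T ≠ 0 ∧ ∀ f, IsRealStable f → IsRealStable (T f) ∨ T f = 0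

/-- The diagonal operator determined by `z^α ↦ lam(α) z^α`. -/
def diagonalOp {n : ℕ} (lam : (Fin n → ℕ) → ℝ) : PolyOp n :=
  (MvPolynomial.basisMonomials (Fin n) ℂ).constr ℂ
    (fun α => MvPolynomial.monomial α (lam α : ℂ))

/-- `f` is a nonzero polynomial whose complex zeros are all real and nonpositive. -/
def HasOnlyRealNonposZeros (f : Polynomial ℝ) : Prop :=
  f ≠ 0 ∧ ∀ x : ℂ, Polynomial.aeval x f = 0 → x.im = 0 ∧ x.re ≤ 0

/-- The polynomial `f₁(z₁w₁) f₂(z₂w₂) ⋯ fₙ(zₙwₙ)`. -/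
def productSymbol {n : ℕ} (f : Fin n → Polynomial ℝ) : MvPolynomial (Fin n ⊕ Fin n) ℂ :=
  ∏ i, Polynomial.aeval (MvPolynomial.X (Sum.inl i) * MvPolynomial.X (Sum.inr i)) (f i)

end

/-!
A diagonal operator has the symbol `∏ fᵢ(zᵢwᵢ)` exactly when its eigenvalue on `z^α` is
`∏ᵢ Λᵢ(αᵢ)`, where `Λ(k) = ∑ⱼ fⱼ k (k - 1) ⋯ (k - j + 1)` is attached to `f` by `fallingEval`
(`hasSymbol_productSymbol_iff`).

*Sufficiency.* The operator is a composition of operators in one variable each. At a point `z`, the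
operator with symbol `f(zᵢwᵢ)` takes the same value as `f(s ∂ᵢ)` with the scalar `s = zᵢ`, because
the multiplications stand to the left of the derivatives. If `f = c ∏ (t + a)` with `a ≥ 0`, then
`f(s ∂ᵢ)` is a product of commuting factors `a + s ∂ᵢ`. For `Im s > 0` and `a > 0` such a factor
preserves stability, since the logarithmic derivative `∑ 1 / (zᵢ - r)` of a stable polynomial has
nonpositive imaginary part and `-a / s` has positive imaginary part
(`IsStable.smul_add_smul_pderiv`). The case `a = 0` follows by an elementary form of Hurwitz'
theorem for polynomials of bounded degree (`tendsto_eval_eq_zero_of_zeroFree_ball`).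

*Necessity.* The eigenvalues `lam α` are the values of a polynomial `P` at the points of `ℕⁿ`.
Applying the operator to `z^α (1 + zᵢ) (1 ± zⱼ)`, whose image is stable or zero, gives
`lam α * lam (α + eᵢ + eⱼ) = lam (α + eᵢ) * lam (α + eⱼ)` (`mul_eq_mul_of_preserver`). Hence `P` is a
product of polynomials in one variable (`eval_mul_pow_eq_prod`), namely of its sections along the
coordinate lines through a point `b` with `lam b ≠ 0`, and each section is the eigenvalue function
of a stability preserver in one variable, with some symbol `f(zw)`. Applying that operator to
`(1 + z)^m (A + m B z)` and letting `m → ∞` shows that `A f(u) + B u (f + f')(u)` has no zero in the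
upper half plane, for all real `A`, `B` that are not both `0` (`mul_aeval_add_ne_zero`). With `B = 0`
this says that `f` has only real zeros. For a positive zero `r` of `f`, the imaginary part of
`u (f + f')(u) / f(u)` would change sign on the vertical line above `r`, which would give a zero for
`B = 1` and a suitable `A` (`hasOnlyRealNonposZeros_of_eulerOp`).
-/

section

open MvPolynomial

/-! ### Diagonal operators and differential operators on monomials -/

lemma diagonalOp_monomial {n : ℕ} (lam : (Fin n → ℕ) → ℝ) (α : Fin n →₀ ℕ) (c : ℂ) :
    diagonalOp lam (monomial α c) = monomial α (lam α * c) := by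
  have h : monomial α c = c • basisMonomials (Fin n) ℂ α := by
    simp [smul_monomial]
  rw [h, map_smul, diagonalOp, Module.Basis.constr_basis, smul_monomial, smul_eq_mul, mul_comm]

lemma coeff_diagonalOp {n : ℕ} (lam : (Fin n → ℕ) → ℝ) (α : Fin n →₀ ℕ)
    (f : MvPolynomial (Fin n) ℂ) :
    coeff α (diagonalOp lam f) = lam α * coeff α f := by
  induction f using MvPolynomial.induction_on' with
  | monomial β b =>
    rw [diagonalOp_monomial, coeff_monomial, coeff_monomial]
    split_ifs with h
    · rw [← h]
    · simp
  | add p q hp hq => rw [map_add, coeff_add, coeff_add, hp, hq, mul_add]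

lemma pderiv_pow_monomial {n : ℕ} (i : Fin n) (k : ℕ) (α : Fin n →₀ ℕ) (c : ℂ) :
    ((((pderiv i : Derivation ℂ (MvPolynomial (Fin n) ℂ) (MvPolynomial (Fin n) ℂ)) :
      MvPolynomial (Fin n) ℂ →ₗ[ℂ] MvPolynomial (Fin n) ℂ) : PolyOp n) ^ k) (monomial α c) =
    monomial (α - Finsupp.single i k) (c * ((α i).descFactorial k : ℂ)) := by
  induction k with
  | zero => simp
  | succ k ih =>
    rw [pow_succ', Module.End.mul_apply, ih, Derivation.coeFn_coe, pderiv_monomial,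
      tsub_tsub, ← Finsupp.single_add]
    congr 1
    rw [Nat.descFactorial_succ]
    simp only [Finsupp.coe_tsub, Pi.sub_apply, Finsupp.single_eq_same, Nat.cast_mul]
    ring

lemma partialOp_monomial {n : ℕ} (β : Fin n → ℕ) (α : Fin n →₀ ℕ) (c : ℂ) :
    partialOp β (monomial α c) =
      monomial (α - Finsupp.equivFunOnFinite.symm β)
        (c * ∏ i, ((α i).descFactorial (β i) : ℂ)) := by
  -- the operators of a duplicate-free list act on distinct variables, so each sees the exponent `α i`
  have key : ∀ l : List (Fin n), l.Nodup →
      ((l.map fun i => (((pderiv i :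
        Derivation ℂ (MvPolynomial (Fin n) ℂ) (MvPolynomial (Fin n) ℂ)) :
        MvPolynomial (Fin n) ℂ →ₗ[ℂ] MvPolynomial (Fin n) ℂ) : PolyOp n) ^ β i).prod)
          (monomial α c) =
        monomial (α - (l.map fun i => Finsupp.single i (β i)).sum)
          (c * (l.map fun i => ((α i).descFactorial (β i) : ℂ)).prod) := by
    intro l
    induction l with
    | nil => simp
    | cons a l ih =>
      intro hl
      rw [List.nodup_cons] at hl
      have ha : ((l.map fun i => Finsupp.single i (β i)).sum) a = 0 := by
        rw [← Finsupp.applyAddHom_apply, map_list_sum, List.map_map]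
        refine List.sum_eq_zero fun x hx => ?_
        obtain ⟨i, hi, rfl⟩ := List.mem_map.1 hx
        have : i ≠ a := fun h => hl.1 (h ▸ hi)
        simp [this]
      rw [List.map_cons, List.prod_cons, Module.End.mul_apply, ih hl.2, pderiv_pow_monomial,
        List.map_cons, List.sum_cons, List.map_cons, List.prod_cons, tsub_tsub, Finsupp.tsub_apply,
        ha, add_comm]
      congr 1
      simp only [tsub_zero]
      ring
  rw [partialOp, List.ofFn_eq_map, key _ (List.nodup_finRange n)]
  congr 2
  ext i
  rw [← Finsupp.univ_sum_single (Finsupp.equivFunOnFinite.symm β), ← List.ofFn_eq_map,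
    List.sum_ofFn]
  simp

lemma mulMonomialOp_monomial {n : ℕ} (α : Fin n → ℕ) (β : Fin n →₀ ℕ) (c : ℂ) :
    mulMonomialOp α (monomial β c) = monomial (Finsupp.equivFunOnFinite.symm α + β) c := by
  have h : (∏ i, (X i : MvPolynomial (Fin n) ℂ) ^ α i) =
      monomial (Finsupp.equivFunOnFinite.symm α) 1 := by
    rw [monomial_eq, Finsupp.prod_fintype _ _ (by simp)]
    simp
  rw [mulMonomialOp, LinearMap.mulLeft_apply, h, monomial_mul, one_mul]

/-- The sum that defines `diffOp F` may run over any finite set containing the support of `F`. -/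
lemma diffOp_eq_sum {n : ℕ} (F : MvPolynomial (Fin n ⊕ Fin n) ℂ)
    {S : Finset (Fin n ⊕ Fin n →₀ ℕ)} (hS : F.support ⊆ S) :
    diffOp F = ∑ m ∈ S, F.coeff m •
      (mulMonomialOp (fun i => m (Sum.inl i)) * partialOp (fun i => m (Sum.inr i))) := by
  refine Finset.sum_subset hS fun m _ hm => ?_
  rw [notMem_support_iff.1 hm, zero_smul]

lemma diffOp_add {n : ℕ} (F G : MvPolynomial (Fin n ⊕ Fin n) ℂ) :
    diffOp (F + G) = diffOp F + diffOp G := by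
  classical
  rw [diffOp_eq_sum (F + G) support_add, diffOp_eq_sum F Finset.subset_union_left,
    diffOp_eq_sum G Finset.subset_union_right, ← Finset.sum_add_distrib]
  simp only [coeff_add, add_smul]

lemma diffOp_sum {n : ℕ} {ι : Type*} (s : Finset ι) (F : ι → MvPolynomial (Fin n ⊕ Fin n) ℂ) :
    diffOp (∑ i ∈ s, F i) = ∑ i ∈ s, diffOp (F i) :=
  map_sum (AddMonoidHom.mk' diffOp diffOp_add) F s

lemma diffOp_monomial {n : ℕ} (m : Fin n ⊕ Fin n →₀ ℕ) (c : ℂ) :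
    diffOp (monomial m c) =
      c • (mulMonomialOp (fun i => m (Sum.inl i)) * partialOp (fun i => m (Sum.inr i))) := by
  rw [diffOp_eq_sum (monomial m c) support_monomial_subset]
  simp

lemma mulMonomialOp_partialOp_monomial {n : ℕ} (β γ : Fin n → ℕ) (α : Fin n →₀ ℕ) (c : ℂ) :
    (mulMonomialOp β * partialOp γ) (monomial α c) =
      monomial (Finsupp.equivFunOnFinite.symm β + (α - Finsupp.equivFunOnFinite.symm γ))
        (c * ∏ i, ((α i).descFactorial (γ i) : ℂ)) := by
  rw [Module.End.mul_apply, partialOp_monomial, mulMonomialOp_monomial]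

/-- If `α - β` truncates, then the falling factorial at that coordinate vanishes. -/
lemma mulMonomialOp_partialOp_self_monomial {n : ℕ} (β : Fin n → ℕ) (α : Fin n →₀ ℕ) (c : ℂ) :
    (mulMonomialOp β * partialOp β) (monomial α c) =
      monomial α (c * ∏ i, ((α i).descFactorial (β i) : ℂ)) := by
  rw [mulMonomialOp_partialOp_monomial]
  by_cases h : ∀ i, β i ≤ α i
  · have hα : Finsupp.equivFunOnFinite.symm β + (α - Finsupp.equivFunOnFinite.symm β) = α :=
      add_tsub_cancel_of_le fun i => h i
    rw [hα]
  · push Not at h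
    obtain ⟨i, hi⟩ := h
    rw [Finset.prod_eq_zero (Finset.mem_univ i)]
    · simp
    · simp [Nat.descFactorial_eq_zero_iff_lt.2 hi]

/-! ### The eigenvalues of a diagonal differential operator -/

/-- The value `∑ⱼ fⱼ k (k - 1) ⋯ (k - j + 1)`: the eigenvalue on `zᵏ` of the operator
`∑ⱼ fⱼ zʲ ∂ʲ` in one variable, whose symbol is `f(zw)`. -/
noncomputable def fallingEval (f : Polynomial ℝ) (k : ℕ) : ℝ :=
  ∑ j ∈ f.support, f.coeff j * k.descFactorial j

lemma fallingEval_eq_sum (f : Polynomial ℝ) (k : ℕ) {S : Finset ℕ} (hS : f.support ⊆ S) :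
    fallingEval f k = ∑ j ∈ S, f.coeff j * k.descFactorial j := by
  refine Finset.sum_subset hS fun m _ hm => ?_
  rw [Polynomial.notMem_support_iff.1 hm, zero_mul]

lemma fallingEval_add (f g : Polynomial ℝ) (k : ℕ) :
    fallingEval (f + g) k = fallingEval f k + fallingEval g k := by
  classical
  rw [fallingEval_eq_sum _ _ Polynomial.support_add,
    fallingEval_eq_sum f _ Finset.subset_union_left,
    fallingEval_eq_sum g _ Finset.subset_union_right, ← Finset.sum_add_distrib]
  simp only [Polynomial.coeff_add, add_mul]

lemma fallingEval_sum {ι : Type*} (s : Finset ι) (f : ι → Polynomial ℝ) (k : ℕ) :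
    fallingEval (∑ i ∈ s, f i) k = ∑ i ∈ s, fallingEval (f i) k :=
  map_sum (AddMonoidHom.mk' (fun f => fallingEval f k) fun f g => fallingEval_add f g k) f s

lemma fallingEval_monomial (j : ℕ) (c : ℝ) (k : ℕ) :
    fallingEval (Polynomial.monomial j c) k = c * k.descFactorial j := by
  rw [fallingEval_eq_sum _ _ (Polynomial.support_monomial_subset j c)]
  simp

lemma fallingEval_C_mul (a : ℝ) (f : Polynomial ℝ) (k : ℕ) :
    fallingEval (Polynomial.C a * f) k = a * fallingEval f k := by
  have h : (Polynomial.C a * f).support ⊆ f.support := by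
    intro j
    simp only [Polynomial.mem_support_iff, Polynomial.coeff_C_mul]
    exact fun h => right_ne_zero_of_mul h
  rw [fallingEval_eq_sum _ _ h, fallingEval, Finset.mul_sum]
  simp only [Polynomial.coeff_C_mul, mul_assoc]

/-- The falling factorials are linearly independent: on the lowest degree `j` of `f`, the value is
`fⱼ j!`. -/
lemma exists_fallingEval_ne_zero {f : Polynomial ℝ} (hf : f ≠ 0) : ∃ k, fallingEval f k ≠ 0 := by
  refine ⟨f.natTrailingDegree, ?_⟩
  rw [fallingEval, Finset.sum_eq_single f.natTrailingDegree]
  · rw [Nat.descFactorial_self]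
    exact mul_ne_zero (Polynomial.trailingCoeff_nonzero_iff_nonzero.2 hf)
      (Nat.cast_ne_zero.2 (Nat.factorial_ne_zero _))
  · intro j hj hne
    have h : f.natTrailingDegree < j :=
      lt_of_le_of_ne (Polynomial.natTrailingDegree_le_of_mem_supp j hj) hne.symm
    simp [Nat.descFactorial_eq_zero_iff_lt.2 h]
  · intro h
    simp [Polynomial.notMem_support_iff.1 h]

lemma productSymbol_eq_sum {n : ℕ} (f : Fin n → Polynomial ℝ) :
    productSymbol f = ∑ β ∈ Fintype.piFinset fun i => (f i).support,
      monomial (Finsupp.equivFunOnFinite.symm (Sum.elim β β)) ((∏ i, (f i).coeff (β i) : ℝ) : ℂ) := by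
  have h : ∀ i, Polynomial.aeval (X (Sum.inl i) * X (Sum.inr i) :
      MvPolynomial (Fin n ⊕ Fin n) ℂ) (f i) = ∑ j ∈ (f i).support,
        C ((f i).coeff j : ℂ) * (X (Sum.inl i) * X (Sum.inr i)) ^ j := by
    intro i
    rw [Polynomial.aeval_def, Polynomial.eval₂_eq_sum, Polynomial.sum]
    rfl
  simp only [productSymbol, h]
  rw [Finset.prod_univ_sum]
  refine Finset.sum_congr rfl fun β _ => ?_
  rw [monomial_eq, Finsupp.prod_fintype _ _ (by simp), Finset.prod_mul_distrib]
  simp [Fintype.prod_sum_type, mul_pow, Finset.prod_mul_distrib]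

lemma diffOp_productSymbol_monomial {n : ℕ} (f : Fin n → Polynomial ℝ) (α : Fin n →₀ ℕ) (c : ℂ) :
    diffOp (productSymbol f) (monomial α c) =
      monomial α (((∏ i, fallingEval (f i) (α i) : ℝ) : ℂ) * c) := by
  rw [productSymbol_eq_sum, diffOp_sum, LinearMap.sum_apply]
  simp only [diffOp_monomial, LinearMap.smul_apply, Finsupp.equivFunOnFinite_symm_apply_apply,
    Sum.elim_inl, Sum.elim_inr, mulMonomialOp_partialOp_self_monomial, smul_monomial, smul_eq_mul]
  rw [← map_sum]
  congr 1
  simp only [fallingEval, Finset.prod_univ_sum]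
  push_cast
  rw [Finset.sum_mul]
  refine Finset.sum_congr rfl fun β _ => ?_
  rw [Finset.prod_mul_distrib]
  ring

/-- A diagonal operator has the product symbol exactly when its eigenvalues are the products of the
one-variable eigenvalues. Both directions of the theorem use the symbol only in this form. -/
lemma hasSymbol_productSymbol_iff {n : ℕ} (lam : (Fin n → ℕ) → ℝ) (f : Fin n → Polynomial ℝ) :
    HasSymbol (diagonalOp lam) (productSymbol f) ↔
      ∀ α, lam α = ∏ i, fallingEval (f i) (α i) := by
  constructor
  · intro h α
    have h1 := congrArg (fun T : PolyOp n => coeff (Finsupp.equivFunOnFinite.symm α)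
      (T (monomial (Finsupp.equivFunOnFinite.symm α) 1))) h
    simp only [diagonalOp_monomial, diffOp_productSymbol_monomial, coeff_monomial, if_true,
      mul_one] at h1
    simpa using Complex.ofReal_injective h1
  · intro h
    refine (basisMonomials (Fin n) ℂ).ext fun α => ?_
    rw [coe_basisMonomials, diagonalOp_monomial, diffOp_productSymbol_monomial, h]

lemma hasRealCoeffs_map {σ : Type*} (f : MvPolynomial σ ℝ) :
    HasRealCoeffs (map Complex.ofRealHom f) := by
  intro m
  simp [coeff_map]

lemma hasRealCoeffs_productSymbol {n : ℕ} (f : Fin n → Polynomial ℝ) :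
    HasRealCoeffs (productSymbol f) := by
  have h : productSymbol f = map Complex.ofRealHom
      (∏ i, Polynomial.aeval (X (Sum.inl i) * X (Sum.inr i)) (f i)) := by
    rw [productSymbol, map_prod]
    refine Finset.prod_congr rfl fun i _ => ?_
    rw [Polynomial.aeval_def, Polynomial.aeval_def, Polynomial.hom_eval₂, map_mul, map_X, map_X]
    congr 1
    ext1 r
    exact (map_C Complex.ofRealHom r).symm
  rw [h]
  exact hasRealCoeffs_map _

/-- The eigenvalues of a diagonal operator in the real Weyl algebra are real linear combinations of
products of falling factorials. -/
lemma exists_eigenvalue_expansion {n : ℕ} {lam : (Fin n → ℕ) → ℝ}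
    (h : IsRealDiffOp (diagonalOp lam)) :
    ∃ (S : Finset (Fin n ⊕ Fin n →₀ ℕ)) (g : (Fin n ⊕ Fin n →₀ ℕ) → ℝ), ∀ α : Fin n → ℕ,
      lam α = ∑ m ∈ S, g m * ∏ i, ((α i).descFactorial (m (Sum.inr i)) : ℝ) := by
  classical
  obtain ⟨F, -, hF⟩ := h
  -- only the terms with equal exponents of `z` and `w` contribute to the coefficient of `z^α`
  refine ⟨F.support.filter fun m => ∀ i, m (Sum.inl i) = m (Sum.inr i),
    fun m => (F.coeff m).re, fun α => ?_⟩
  set a : Fin n →₀ ℕ := Finsupp.equivFunOnFinite.symm α with ha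
  have h1 := congrArg (fun T : PolyOp n => coeff a (T (monomial a 1))) hF
  simp only [diagonalOp_monomial, coeff_monomial, if_true, mul_one, diffOp, LinearMap.sum_apply,
    LinearMap.smul_apply, mulMonomialOp_partialOp_monomial, coeff_sum, coeff_smul, one_mul] at h1
  have h2 := congrArg Complex.re h1
  rw [Finset.sum_filter]
  simp only [ha, Finsupp.coe_equivFunOnFinite_symm, Complex.ofReal_re, Complex.re_sum] at h2
  rw [h2]
  refine Finset.sum_congr rfl fun m _ => ?_
  by_cases hle : ∀ i, m (Sum.inr i) ≤ α i
  · have hiff : (Finsupp.equivFunOnFinite.symm (fun i => m (Sum.inl i)) +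
        (Finsupp.equivFunOnFinite.symm α - Finsupp.equivFunOnFinite.symm fun i => m (Sum.inr i)) =
        Finsupp.equivFunOnFinite.symm α) ↔ ∀ i, m (Sum.inl i) = m (Sum.inr i) := by
      rw [DFunLike.ext_iff]
      refine forall_congr' fun i => ?_
      have := hle i
      simp
      omega
    simp only [hiff]
    split_ifs
    · rw [smul_eq_mul, ← Nat.cast_prod, ← Nat.cast_prod, ← Complex.ofReal_natCast,
        Complex.re_mul_ofReal]
    · simp
  · push Not at hle
    obtain ⟨i, hi⟩ := hle
    have h0 : (α i).descFactorial (m (Sum.inr i)) = 0 := Nat.descFactorial_eq_zero_iff_lt.2 hi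
    rw [Finset.prod_eq_zero (Finset.mem_univ i) (by simp [h0]),
      Finset.prod_eq_zero (Finset.mem_univ i) (by simp [h0])]
    simp

/-! ### Limits of zero-free polynomials of bounded degree -/

/-- A Harnack-type bound: every root `r` has distance at least `ρ` from `z₀`, so that
`‖w - r‖ ≤ (1 + ‖w - z₀‖ / ρ) ‖z₀ - r‖`. -/
lemma norm_eval_le_of_zeroFree_ball {p : Polynomial ℂ} {N : ℕ} (hN : p.natDegree ≤ N) {z₀ : ℂ}
    {ρ : ℝ} (hρ : 0 < ρ) (hp : ∀ z ∈ Metric.ball z₀ ρ, p.eval z ≠ 0) (w : ℂ) :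
    ‖p.eval w‖ ≤ (1 + ‖w - z₀‖ / ρ) ^ N * ‖p.eval z₀‖ := by
  have hp0 : p ≠ 0 := by
    rintro rfl
    exact hp z₀ (Metric.mem_ball_self hρ) (by simp)
  set K := 1 + ‖w - z₀‖ / ρ with hK
  have hK1 : 1 ≤ K := by
    have : 0 ≤ ‖w - z₀‖ / ρ := by positivity
    linarith
  have hroot : ∀ r ∈ p.roots, ‖w - r‖ ≤ K * ‖z₀ - r‖ := by
    intro r hr
    have h1 : ρ ≤ ‖z₀ - r‖ := by
      by_contra! hlt
      refine hp r ?_ (Polynomial.isRoot_of_mem_roots hr)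
      rwa [Metric.mem_ball, dist_comm, dist_eq_norm]
    calc ‖w - r‖ = ‖(w - z₀) + (z₀ - r)‖ := by congr 1; ring
      _ ≤ ‖w - z₀‖ + ‖z₀ - r‖ := norm_add_le _ _
      _ = ‖w - z₀‖ / ρ * ρ + ‖z₀ - r‖ := by field_simp
      _ ≤ ‖w - z₀‖ / ρ * ‖z₀ - r‖ + ‖z₀ - r‖ := by gcongr
      _ = K * ‖z₀ - r‖ := by rw [hK]; ring
  have hprod : ∀ s : Multiset ℂ, (∀ r ∈ s, ‖w - r‖ ≤ K * ‖z₀ - r‖) →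
      ‖(s.map fun r => w - r).prod‖ ≤ K ^ s.card * ‖(s.map fun r => z₀ - r).prod‖ := by
    intro s
    induction s using Multiset.induction_on with
    | empty => simp
    | cons a s ih =>
      intro h
      rw [Multiset.map_cons, Multiset.prod_cons, Multiset.map_cons, Multiset.prod_cons,
        Multiset.card_cons, norm_mul, norm_mul, pow_succ]
      calc _ ≤ (K * ‖z₀ - a‖) * (K ^ s.card * ‖(s.map fun r => z₀ - r).prod‖) := by
            gcongr
            · exact h a (Multiset.mem_cons_self a s)
            · exact ih fun r hr => h r (Multiset.mem_cons_of_mem hr)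
        _ = _ := by ring
  rw [(IsAlgClosed.splits p).eval_eq_prod_roots, (IsAlgClosed.splits p).eval_eq_prod_roots,
    norm_mul, norm_mul]
  calc _ ≤ ‖p.leadingCoeff‖ * (K ^ p.roots.card * ‖(p.roots.map fun r => z₀ - r).prod‖) := by
        gcongr
        exact hprod _ hroot
    _ ≤ ‖p.leadingCoeff‖ * (K ^ N * ‖(p.roots.map fun r => z₀ - r).prod‖) := by
        gcongr
        exact p.card_roots'.trans hN
    _ = _ := by ring

/-- Hurwitz' theorem for polynomials of bounded degree: if polynomials that are zero or have no
zero in a disc converge pointwise, then the limit vanishes identically as soon as it vanishes at the centre. -/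
lemma tendsto_eval_eq_zero_of_zeroFree_ball {ι : Type*} {l : Filter ι} [l.NeBot]
    {p : ι → Polynomial ℂ} {N : ℕ} (hN : ∀ i, (p i).natDegree ≤ N) {z₀ : ℂ} {ρ : ℝ} (hρ : 0 < ρ)
    (hp : ∀ᶠ i in l, (∀ z ∈ Metric.ball z₀ ρ, (p i).eval z ≠ 0) ∨ p i = 0) {g : ℂ → ℂ}
    (hg : ∀ w, Filter.Tendsto (fun i => (p i).eval w) l (nhds (g w))) (hz : g z₀ = 0) (w : ℂ) :
    g w = 0 := by
  have hle : ‖g w‖ ≤ (1 + ‖w - z₀‖ / ρ) ^ N * ‖g z₀‖ := by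
    refine le_of_tendsto_of_tendsto (hg w).norm ((hg z₀).norm.const_mul _) ?_
    filter_upwards [hp] with i hi
    rcases hi with hi | hi
    · exact norm_eval_le_of_zeroFree_ball (hN i) hρ hi w
    · simp [hi]
  rw [hz, norm_zero, mul_zero] at hle
  exact norm_le_zero_iff.1 hle

/-! ### Differential operators preserving stability -/

lemma eval_aeval_line {n : ℕ} (h : MvPolynomial (Fin n) ℂ) (a b : Fin n → ℂ) (t : ℂ) :
    (aeval (fun j => Polynomial.C (a j) + Polynomial.X * Polynomial.C (b j)) h).eval t =
      eval (fun j => a j + t * b j) h := by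
  induction h using MvPolynomial.induction_on with
  | C c => simp
  | add p q hp hq => simp only [map_add, Polynomial.eval_add, hp, hq]
  | mul_X p j hp =>
    rw [map_mul, Polynomial.eval_mul, hp]
    simp [mul_comm t]

lemma derivative_aeval_line {n : ℕ} (h : MvPolynomial (Fin n) ℂ) (a : Fin n → ℂ) (i : Fin n) :
    Polynomial.derivative (aeval (fun j => Polynomial.C (a j) + Polynomial.X *
        Polynomial.C ((Pi.single i 1 : Fin n → ℂ) j)) h) =
      aeval (fun j => Polynomial.C (a j) + Polynomial.X *
        Polynomial.C ((Pi.single i 1 : Fin n → ℂ) j)) (pderiv i h) := by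
  set L : MvPolynomial (Fin n) ℂ →ₐ[ℂ] Polynomial ℂ := aeval (fun j => Polynomial.C (a j) +
    Polynomial.X * Polynomial.C ((Pi.single i 1 : Fin n → ℂ) j)) with hL
  have hX : ∀ j, Polynomial.derivative (L (X j)) = L (pderiv i (X j)) := by
    intro j
    by_cases hij : j = i
    · subst hij; simp [hL]
    · simp [hL, hij, pderiv_X]
  induction h using MvPolynomial.induction_on with
  | C c => simp
  | add p q hp hq => simp only [map_add, hp, hq]
  | mul_X p j hp =>
    rw [map_mul, Polynomial.derivative_mul, hp, hX, Derivation.leibniz]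
    simp only [smul_eq_mul, map_add, map_mul]
    ring

lemma im_sum_one_div_nonpos (s : Multiset ℂ) (z : ℂ) (h : ∀ r ∈ s, 0 ≤ (z - r).im) :
    ((s.map fun r => 1 / (z - r)).sum).im ≤ 0 := by
  induction s using Multiset.induction_on with
  | empty => simp
  | cons a s ih =>
    rw [Multiset.map_cons, Multiset.sum_cons, Complex.add_im]
    refine add_nonpos ?_ (ih fun r hr => h r (Multiset.mem_cons_of_mem hr))
    rw [one_div, Complex.inv_im]
    exact div_nonpos_of_nonpos_of_nonneg
      (neg_nonpos.2 (h a (Multiset.mem_cons_self a s))) (Complex.normSq_nonneg _)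

/-- For `a > 0` and `Im s > 0` the operator `a + s ∂ᵢ` preserves stability: in the variable `zᵢ` the
logarithmic derivative `∑ᵣ 1 / (zᵢ - r)` of a stable polynomial has imaginary part at most `0`, and
`-a / s` has positive imaginary part. -/
lemma IsStable.smul_add_smul_pderiv {n : ℕ} {h : MvPolynomial (Fin n) ℂ} (hh : IsStable h)
    (i : Fin n) {a : ℝ} (ha : 0 < a) {s : ℂ} (hs : 0 < s.im) :
    IsStable ((a : ℂ) • h + s • pderiv i h) := by
  intro z hz h0
  set a₀ : Fin n → ℂ := Function.update z i 0
  set p := aeval (fun j => Polynomial.C (a₀ j) + Polynomial.X *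
        Polynomial.C ((Pi.single i 1 : Fin n → ℂ) j)) h with hpdef
  have hpt : ∀ t, (fun j => a₀ j + t * (Pi.single i 1 : Fin n → ℂ) j) = Function.update z i t := by
    intro t
    ext j
    by_cases hij : j = i
    · subst hij; simp [a₀]
    · simp [a₀, hij]
  have hpe : ∀ t, p.eval t = eval (Function.update z i t) h := by
    intro t
    rw [hpdef, eval_aeval_line, hpt]
  have hpd : (Polynomial.derivative p).eval (z i) = eval z (pderiv i h) := by
    rw [hpdef, derivative_aeval_line, eval_aeval_line, hpt, Function.update_eq_self]
  have hne : p.eval (z i) ≠ 0 := by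
    rw [hpe, Function.update_eq_self]
    exact hh z hz
  have hq := (IsAlgClosed.splits p).eval_derivative_eq_eval_mul_sum hne
  set q := (p.roots.map fun r => 1 / (z i - r)).sum with hqdef
  have him : q.im ≤ 0 := by
    refine im_sum_one_div_nonpos _ _ fun r hr => ?_
    by_contra! hlt
    rw [Complex.sub_im] at hlt
    have hr0 : p.eval r = 0 := Polynomial.isRoot_of_mem_roots hr
    rw [hpe] at hr0
    refine hh _ (fun j => ?_) hr0
    by_cases hij : j = i
    · subst hij
      have := hz j
      simp only [Function.update_self]
      linarith
    · simpa [hij] using hz j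
  rw [map_add, smul_eval, smul_eval, ← hpd, hq] at h0
  have hze : eval z h = p.eval (z i) := by rw [hpe, Function.update_eq_self]
  rw [hze] at h0
  have h1 : (a : ℂ) + s * q = 0 := by
    have : p.eval (z i) * ((a : ℂ) + s * q) = 0 := by rw [← h0]; ring
    exact (mul_eq_zero.1 this).resolve_left hne
  have hre := congrArg Complex.re h1
  have him2 := congrArg Complex.im h1
  simp at hre him2
  have h2 : a * s.im = (s.re ^ 2 + s.im ^ 2) * q.im := by
    linear_combination s.im * hre - s.re * him2
  have h3 : (s.re ^ 2 + s.im ^ 2) * q.im ≤ 0 := mul_nonpos_of_nonneg_of_nonpos (by positivity) him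
  have h4 : 0 < a * s.im := mul_pos ha hs
  linarith

lemma IsStable.smul {n : ℕ} {h : MvPolynomial (Fin n) ℂ} (hh : IsStable h) {c : ℂ} (hc : c ≠ 0) :
    IsStable (c • h) := by
  intro z hz
  rw [smul_eval]
  exact mul_ne_zero hc (hh z hz)

/-- `∂ᵢ` preserves stability up to `0`: the operators `ε + I ∂ᵢ` with `ε > 0` preserve stability and
tend to `I ∂ᵢ`. -/
lemma IsStable.pderiv {n : ℕ} {h : MvPolynomial (Fin n) ℂ} (hh : IsStable h) (i : Fin n) :
    IsStable (MvPolynomial.pderiv i h) ∨ MvPolynomial.pderiv i h = 0 := by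
  by_contra! hcon
  obtain ⟨hns, hne⟩ := hcon
  refine hne (MvPolynomial.funext fun w => ?_)
  simp only [IsStable] at hns
  push Not at hns
  obtain ⟨z, hz, hz0⟩ := hns
  set L : MvPolynomial (Fin n) ℂ →ₐ[ℂ] Polynomial ℂ :=
    aeval (fun j => Polynomial.C (z j) + Polynomial.X * Polynomial.C (w j - z j)) with hL
  set q : ℕ → MvPolynomial (Fin n) ℂ := fun m =>
    (((1 : ℝ) / (m + 1) : ℝ) : ℂ) • h + Complex.I • MvPolynomial.pderiv i h with hq
  have hqs : ∀ m, IsStable (q m) := fun m =>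
    hh.smul_add_smul_pderiv i (by positivity) (by simp)
  -- on a small disc the line through `z` and `w` stays in the product of half planes
  obtain ⟨ρ, hρ, hball⟩ : ∃ ρ > 0, ∀ t ∈ Metric.ball (0 : ℂ) ρ,
      ∀ j, 0 < (z j + t * (w j - z j)).im := by
    have hev : ∀ᶠ t in nhds (0 : ℂ), ∀ j, 0 < (z j + t * (w j - z j)).im := by
      rw [Filter.eventually_all]
      intro j
      have hc : Continuous fun t : ℂ => (z j + t * (w j - z j)).im := by fun_prop
      exact hc.continuousAt.eventually_const_lt (by simpa using hz j)
    exact Metric.eventually_nhds_iff_ball.1 hev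
  have hfin := tendsto_eval_eq_zero_of_zeroFree_ball (l := Filter.atTop) (p := fun m => L (q m))
    (N := max (L h).natDegree (L (MvPolynomial.pderiv i h)).natDegree) (z₀ := 0)
    (g := fun t => Complex.I * (L (MvPolynomial.pderiv i h)).eval t) ?_ hρ ?_ ?_ ?_ 1
  · rw [hL, eval_aeval_line] at hfin
    simpa using hfin
  · intro m
    simp only [hq, map_add, map_smul]
    exact (Polynomial.natDegree_add_le _ _).trans
      (max_le_max (Polynomial.natDegree_smul_le _ _) (Polynomial.natDegree_smul_le _ _))
  · refine Filter.Eventually.of_forall fun m => Or.inl fun t ht => ?_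
    rw [hL, eval_aeval_line]
    exact hqs m _ (hball t ht)
  · intro t
    simp only [hq, map_add, map_smul, Polynomial.eval_add, Polynomial.eval_smul, smul_eq_mul]
    have h1 : Filter.Tendsto (fun m : ℕ => (((1 : ℝ) / (m + 1) : ℝ) : ℂ)) Filter.atTop
        (nhds 0) := by
      have := (Complex.continuous_ofReal.tendsto 0).comp
        (tendsto_one_div_add_atTop_nhds_zero_nat (𝕜 := ℝ))
      exact this
    simpa using (h1.mul_const ((L h).eval t)).add_const
      (Complex.I * (L (MvPolynomial.pderiv i h)).eval t)
  · rw [hL, eval_aeval_line]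
    simpa using hz0

/-! ### Sufficiency: normally ordered products of linear factors -/

/-- `∂ᵢ` as an element of the algebra of linear operators. -/
noncomputable def pderivOp {n : ℕ} (i : Fin n) : PolyOp n :=
  ((pderiv i : Derivation ℂ (MvPolynomial (Fin n) ℂ) (MvPolynomial (Fin n) ℂ)) :
    MvPolynomial (Fin n) ℂ →ₗ[ℂ] MvPolynomial (Fin n) ℂ)

/-- For a fixed `s`, the factors `a + s ∂ᵢ` commute. Those with `a > 0` preserve stability; one with
`a = 0` is applied first, and it either preserves stability for every `s` or gives `0` for
every `s`. -/
lemma isStable_aeval_prod_or_eq_zero {n : ℕ} (i : Fin n) (A : Multiset ℝ) (hA : ∀ a ∈ A, 0 ≤ a) :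
    ∀ {h : MvPolynomial (Fin n) ℂ}, IsStable h →
      (∀ s : ℂ, 0 < s.im → IsStable (Polynomial.aeval (s • pderivOp i)
        (A.map fun a : ℝ => (Polynomial.X + Polynomial.C (a : ℂ))).prod h)) ∨
      ∀ s : ℂ, Polynomial.aeval (s • pderivOp i)
        (A.map fun a : ℝ => (Polynomial.X + Polynomial.C (a : ℂ))).prod h = 0 := by
  induction A using Multiset.induction_on with
  | empty => intro h hh; exact Or.inl fun s _ => by simpa using hh
  | cons a A ih =>
    intro h hh
    replace ih := @ih fun b hb => hA b (Multiset.mem_cons_of_mem hb)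
    rcases (hA a (Multiset.mem_cons_self a A)).eq_or_lt with ha | ha
    · have key : ∀ s : ℂ, Polynomial.aeval (s • pderivOp i)
          ((a ::ₘ A).map fun a : ℝ => (Polynomial.X + Polynomial.C (a : ℂ))).prod h =
          s • Polynomial.aeval (s • pderivOp i)
            (A.map fun a : ℝ => (Polynomial.X + Polynomial.C (a : ℂ))).prod (pderiv i h) := by
        intro s
        rw [Multiset.map_cons, Multiset.prod_cons, mul_comm, map_mul, Module.End.mul_apply,
          ← ha, ← map_smul]
        simp [pderivOp]
      simp only [key]
      rcases hh.pderiv i with hd | hd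
      · rcases ih hd with h1 | h1
        · refine Or.inl fun s hs => (h1 s hs).smul ?_
          rintro rfl
          simp at hs
        · exact Or.inr fun s => by rw [h1, smul_zero]
      · exact Or.inr fun s => by rw [hd, map_zero, smul_zero]
    · have key : ∀ s : ℂ, Polynomial.aeval (s • pderivOp i)
          ((a ::ₘ A).map fun a : ℝ => (Polynomial.X + Polynomial.C (a : ℂ))).prod h =
          (a : ℂ) • Polynomial.aeval (s • pderivOp i)
            (A.map fun a : ℝ => (Polynomial.X + Polynomial.C (a : ℂ))).prod h +
          s • pderiv i (Polynomial.aeval (s • pderivOp i)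
            (A.map fun a : ℝ => (Polynomial.X + Polynomial.C (a : ℂ))).prod h) := by
        intro s
        rw [Multiset.map_cons, Multiset.prod_cons, map_mul, Module.End.mul_apply]
        simp [pderivOp, Algebra.algebraMap_eq_smul_one, add_comm]
      simp only [key]
      rcases ih hh with h1 | h1
      · exact Or.inl fun s hs => (h1 s hs).smul_add_smul_pderiv i ha hs
      · exact Or.inr fun s => by simp [h1 s]

/-- At a point `z`, normal ordering lets the multiplications by `zᵢ` be replaced by the scalar
`s = zᵢ`, which commutes with `∂ᵢ`. -/
lemma eval_diagonalOp_fallingEval {n : ℕ} (i : Fin n) (f : Polynomial ℝ)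
    (h : MvPolynomial (Fin n) ℂ) (z : Fin n → ℂ) :
    eval z (diagonalOp (fun α => fallingEval f (α i)) h) =
      eval z (Polynomial.aeval (z i • pderivOp i) (f.map Complex.ofRealHom) h) := by
  have hpow : ∀ (j : ℕ) (α : Fin n →₀ ℕ) (c : ℂ),
      z i ^ j * eval z ((pderivOp i ^ j) (monomial α c)) =
        ((α i).descFactorial j : ℂ) * eval z (monomial α c) := by
    intro j α c
    rw [pderivOp, pderiv_pow_monomial, eval_monomial, eval_monomial]
    by_cases hj : j ≤ α i
    · have hα : Finsupp.single i j + (α - Finsupp.single i j) = α :=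
        add_tsub_cancel_of_le (Finsupp.single_le_iff.2 hj)
      conv_rhs => rw [← hα]
      rw [Finsupp.prod_add_index' (by simp) (by simp [pow_add]), Finsupp.prod_single_index (by simp)]
      rw [hα]
      ring
    · rw [Nat.descFactorial_eq_zero_iff_lt.2 (not_le.1 hj)]
      simp
  induction h using MvPolynomial.induction_on' with
  | monomial α c =>
    rw [diagonalOp_monomial, Polynomial.aeval_def, Polynomial.eval₂_map, Polynomial.eval₂_eq_sum,
      Polynomial.sum, LinearMap.sum_apply, map_sum, ← smul_eq_mul, ← smul_monomial, smul_eval,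
      fallingEval]
    push_cast
    rw [Finset.sum_mul]
    refine Finset.sum_congr rfl fun j _ => ?_
    rw [mul_assoc, ← hpow]
    simp only [RingHom.comp_apply, Complex.ofRealHom_eq_coe, Algebra.algebraMap_eq_smul_one,
      smul_pow, smul_mul_assoc, one_mul, LinearMap.smul_apply, smul_eval]
  | add p q hp hq => simp only [map_add, hp, hq]

lemma IsStable.diagonalOp_fallingEval {n : ℕ} {h : MvPolynomial (Fin n) ℂ} (hh : IsStable h)
    (i : Fin n) {f : Polynomial ℝ} (hf : HasOnlyRealNonposZeros f) :
    IsStable (diagonalOp (fun α => fallingEval f (α i)) h) ∨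
      diagonalOp (fun α => fallingEval f (α i)) h = 0 := by
  set p := f.map Complex.ofRealHom with hp
  have hp0 : p ≠ 0 := by
    rw [hp, Ne, Polynomial.map_eq_zero]
    exact hf.1
  have hroots : ∀ r ∈ p.roots, r.im = 0 ∧ r.re ≤ 0 := by
    intro r hr
    refine hf.2 r ?_
    have : p.eval r = 0 := Polynomial.isRoot_of_mem_roots hr
    rwa [hp, Polynomial.eval_map] at this
  set A : Multiset ℝ := p.roots.map fun r => -r.re with hA
  have hfac : p = Polynomial.C p.leadingCoeff *
      (A.map fun a : ℝ => (Polynomial.X + Polynomial.C (a : ℂ))).prod := by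
    conv_lhs => rw [(IsAlgClosed.splits p).eq_prod_roots]
    rw [hA, Multiset.map_map]
    congr 2
    refine Multiset.map_congr rfl fun r hr => ?_
    have : ((-r.re : ℝ) : ℂ) = -r := by
      apply Complex.ext <;> simp [(hroots r hr).1]
    rw [Function.comp_apply, this, Polynomial.C_neg, sub_eq_add_neg]
  have hA0 : ∀ a ∈ A, 0 ≤ a := by
    intro a ha
    obtain ⟨r, hr, rfl⟩ := Multiset.mem_map.1 ha
    exact neg_nonneg.2 (hroots r hr).2
  have heval : ∀ z : Fin n → ℂ, eval z (diagonalOp (fun α => fallingEval f (α i)) h) =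
      p.leadingCoeff * eval z (Polynomial.aeval (z i • pderivOp i)
        (A.map fun a : ℝ => (Polynomial.X + Polynomial.C (a : ℂ))).prod h) := by
    intro z
    rw [eval_diagonalOp_fallingEval, ← hp]
    conv_lhs => rw [hfac]
    rw [map_mul, Polynomial.aeval_C, Algebra.algebraMap_eq_smul_one, smul_mul_assoc, one_mul,
      LinearMap.smul_apply, smul_eval]
  rcases isStable_aeval_prod_or_eq_zero i A hA0 hh with h1 | h1
  · left
    intro z hz
    rw [heval]
    exact mul_ne_zero (Polynomial.leadingCoeff_ne_zero.2 hp0) (h1 _ (hz i) z hz)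
  · right
    refine MvPolynomial.funext fun z => ?_
    rw [heval, h1]
    simp

lemma diagonalOp_mul {n : ℕ} (lam mu : (Fin n → ℕ) → ℝ) (h : MvPolynomial (Fin n) ℂ) :
    diagonalOp (fun α => lam α * mu α) h = diagonalOp lam (diagonalOp mu h) := by
  ext α
  simp only [coeff_diagonalOp]
  push_cast
  ring

lemma IsStable.diagonalOp_prod {n : ℕ} {h : MvPolynomial (Fin n) ℂ} (hh : IsStable h)
    {f : Fin n → Polynomial ℝ} (hf : ∀ i, HasOnlyRealNonposZeros (f i)) (s : Finset (Fin n)) :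
    IsStable (diagonalOp (fun α => ∏ i ∈ s, fallingEval (f i) (α i)) h) ∨
      diagonalOp (fun α => ∏ i ∈ s, fallingEval (f i) (α i)) h = 0 := by
  induction s using Finset.induction_on with
  | empty =>
    left
    have : diagonalOp (fun α => ∏ i ∈ ∅, fallingEval (f i) (α i)) h = h := by
      ext α
      simp [coeff_diagonalOp]
    rwa [this]
  | insert i s his ih =>
    simp only [Finset.prod_insert his]
    rw [diagonalOp_mul (fun α => fallingEval (f i) (α i))]
    rcases ih with ih | ih
    · exact ih.diagonalOp_fallingEval i (hf i)
    · rw [ih, map_zero]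
      exact Or.inr rfl

lemma isFiniteOrderRealStabilityPreserver_of_productSymbol {n : ℕ} {lam : (Fin n → ℕ) → ℝ}
    {f : Fin n → Polynomial ℝ} (hf : ∀ i, HasOnlyRealNonposZeros (f i))
    (h : HasSymbol (diagonalOp lam) (productSymbol f)) :
    IsFiniteOrderRealStabilityPreserver (diagonalOp lam) := by
  have hlam := (hasSymbol_productSymbol_iff lam f).1 h
  refine ⟨⟨_, hasRealCoeffs_productSymbol f, h⟩, fun h0 => ?_, fun p hp => ?_⟩
  -- an exponent at which every factor of the eigenvalue is nonzero
  · choose k hk using fun i => exists_fallingEval_ne_zero (hf i).1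
    have h1 := congrArg (fun T : PolyOp n => coeff (Finsupp.equivFunOnFinite.symm k)
      (T (monomial (Finsupp.equivFunOnFinite.symm k) 1))) h0
    simp only [diagonalOp_monomial, coeff_monomial, if_true, mul_one, LinearMap.zero_apply,
      coeff_zero, Finsupp.coe_equivFunOnFinite_symm, Complex.ofReal_eq_zero, hlam] at h1
    exact Finset.prod_ne_zero_iff.2 (fun i _ => hk i) h1
  · have heq : lam = fun α => ∏ i ∈ Finset.univ, fallingEval (f i) (α i) := _root_.funext hlam
    have hst := hp.1.diagonalOp_prod hf Finset.univ
    rw [← heq] at hst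
    refine hst.imp_left fun hs => ⟨hs, fun m => ?_⟩
    rw [coeff_diagonalOp, Complex.im_ofReal_mul, hp.2 m, mul_zero]

end

section

open Polynomial

/-! ### Multiplier sequences in one variable -/

/-- The operator `∑ⱼ fⱼ zʲ ∂ʲ` in one variable, with symbol `f(zw)`. -/
noncomputable def eulerOp (f q : ℝ[X]) : ℝ[X] :=
  ∑ j ∈ f.support, C (f.coeff j) * X ^ j * derivative^[j] q

lemma coeff_eulerOp (f q : ℝ[X]) (k : ℕ) :
    (eulerOp f q).coeff k = fallingEval f k * q.coeff k := by
  rw [eulerOp, finsetSum_coeff, fallingEval, Finset.sum_mul]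
  refine Finset.sum_congr rfl fun j _ => ?_
  rw [mul_assoc, coeff_C_mul, coeff_X_pow_mul', mul_assoc]
  congr 1
  split_ifs with h
  · rw [coeff_iterate_derivative, Nat.sub_add_cancel h, nsmul_eq_mul]
  · rw [Nat.descFactorial_eq_zero_iff_lt.2 (not_le.1 h)]
    simp

lemma eulerOp_add (f p q : ℝ[X]) : eulerOp f (p + q) = eulerOp f p + eulerOp f q := by
  ext k
  simp only [coeff_eulerOp, coeff_add, mul_add]

lemma eulerOp_C_mul (f q : ℝ[X]) (a : ℝ) : eulerOp f (C a * q) = C a * eulerOp f q := by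
  ext k
  simp only [coeff_eulerOp, coeff_C_mul, mul_left_comm]

lemma fallingEval_succ (f : ℝ[X]) (k : ℕ) :
    fallingEval f (k + 1) = fallingEval (f + derivative f) k := by
  induction f using Polynomial.induction_on' with
  | add p q hp hq =>
    rw [fallingEval_add, hp, hq, ← fallingEval_add, derivative_add]
    congr 1
    ring
  | monomial j c =>
    rw [derivative_monomial, fallingEval_add, fallingEval_monomial, fallingEval_monomial,
      fallingEval_monomial]
    cases j with
    | zero => simp
    | succ j =>
      rw [Nat.succ_descFactorial_succ, Nat.descFactorial_succ, Nat.add_sub_cancel]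
      by_cases h : j ≤ k
      · push_cast [Nat.cast_sub h]
        ring
      · rw [Nat.descFactorial_eq_zero_iff_lt.2 (not_le.1 h)]
        simp

lemma eulerOp_X_mul (f q : ℝ[X]) : eulerOp f (X * q) = X * eulerOp (f + derivative f) q := by
  ext k
  cases k with
  | zero => simp [coeff_eulerOp]
  | succ k => simp only [coeff_eulerOp, coeff_X_mul, fallingEval_succ]

/-- The polynomial `∑ⱼ fⱼ m (m - 1) ⋯ (m - j + 1) (u / m)ʲ`, which tends to `f(u)` as `m → ∞`. Up
to a nonvanishing factor and a Möbius substitution, it is the image of `(1 + z)ᵐ` under the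
operator with symbol `f(zw)`. -/
noncomputable def fallingTruncation (f : ℝ[X]) (m : ℕ) : ℂ[X] :=
  ∑ j ∈ f.support, monomial j ((f.coeff j : ℂ) * (m.descFactorial j / (m : ℂ) ^ j))

lemma natDegree_fallingTruncation_le (f : ℝ[X]) (m : ℕ) :
    (fallingTruncation f m).natDegree ≤ f.natDegree :=
  natDegree_sum_le_of_forall_le _ _ fun j hj =>
    (natDegree_monomial_le _).trans (le_natDegree_of_mem_supp j hj)

lemma tendsto_eval_fallingTruncation (f : ℝ[X]) (w : ℂ) :
    Filter.Tendsto (fun m => (fallingTruncation f m).eval w) Filter.atTop (nhds (aeval w f)) := by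
  have h1 : ∀ j : ℕ, Filter.Tendsto (fun m : ℕ => (m.descFactorial j / (m : ℂ) ^ j))
      Filter.atTop (nhds 1) := by
    intro j
    have h2 : Filter.Tendsto (fun m : ℕ => ((m.descFactorial j : ℝ) / (m : ℝ) ^ j))
        Filter.atTop (nhds 1) := by
      refine (Asymptotics.isEquivalent_iff_tendsto_one ?_).1 (isEquivalent_descFactorial j)
      filter_upwards [Filter.eventually_ge_atTop 1] with m hm
      have : (0 : ℝ) < m := by exact_mod_cast hm
      exact pow_ne_zero _ this.ne'
    have h3 := (Complex.continuous_ofReal.tendsto 1).comp h2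
    refine (Complex.ofReal_one ▸ h3).congr fun m => ?_
    simp
  have h4 : aeval w f = ∑ j ∈ f.support, ((f.coeff j : ℂ) * 1) * w ^ j := by
    rw [aeval_def, eval₂_eq_sum, Polynomial.sum]
    simp
  rw [h4]
  simp only [fallingTruncation, eval_finsetSum, eval_monomial]
  exact tendsto_finsetSum _ fun j _ => ((h1 j).const_mul _).mul_const _

lemma aeval_eulerOp_one_add_X_pow (f : ℝ[X]) {m : ℕ} (hm : m ≠ 0) {u : ℂ} (hu : u ≠ m) :
    aeval (u / (m - u)) (eulerOp f ((X + C 1) ^ m)) =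
      (m / (m - u)) ^ m * (fallingTruncation f m).eval u := by
  have hm' : (m : ℂ) ≠ 0 := Nat.cast_ne_zero.2 hm
  have hu' : (m : ℂ) - u ≠ 0 := sub_ne_zero.2 hu.symm
  rw [eulerOp, map_sum, fallingTruncation, eval_finsetSum, Finset.mul_sum]
  refine Finset.sum_congr rfl fun j _ => ?_
  rw [iterate_derivative_X_add_pow, eval_monomial]
  have h1 : u / (m - u) + 1 = (m : ℂ) / (m - u) := by field_simp; ring
  simp only [map_mul, map_pow, map_add, aeval_X, aeval_C, map_one, nsmul_eq_mul, h1,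
    map_natCast, Complex.coe_algebraMap]
  by_cases hj : j ≤ m
  · obtain ⟨l, rfl⟩ := Nat.exists_eq_add_of_le hj
    rw [Nat.add_sub_cancel_left, pow_add, div_pow, div_pow, div_pow]
    field_simp
  · rw [Nat.descFactorial_eq_zero_iff_lt.2 (not_le.1 hj)]
    simp

/-- The operator with symbol `f(zw)` maps `(1 + z)ᵐ (A + m B z)` to a polynomial that is zero-free
in the upper half plane; the Möbius map `z = u / (m - u)` preserves this half plane, and the limit
`m → ∞` gives the claim. -/
lemma mul_aeval_add_ne_zero {f : ℝ[X]} (hf : f ≠ 0)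
    (hU : ∀ q : ℝ[X], (∀ z : ℂ, 0 < z.im → aeval z q ≠ 0) →
      (∀ z : ℂ, 0 < z.im → aeval z (eulerOp f q) ≠ 0) ∨ eulerOp f q = 0)
    {A B : ℝ} (hAB : A ≠ 0 ∨ B ≠ 0) {u : ℂ} (hu : 0 < u.im) :
    A * aeval u f + B * u * aeval u (f + derivative f) ≠ 0 := by
  intro h0
  set f₁ := f + derivative f with hf₁
  have htest : ∀ m : ℕ, eulerOp f ((X + C 1) ^ m * (C A + C (m * B) * X)) =
      C A * eulerOp f ((X + C 1) ^ m) + C (m * B) * (X * eulerOp f₁ ((X + C 1) ^ m)) := by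
    intro m
    rw [← eulerOp_X_mul, ← eulerOp_C_mul, ← eulerOp_C_mul, ← eulerOp_add]
    congr 1
    ring
  set R : ℕ → ℂ[X] := fun m => C (A : ℂ) * (1 - C ((m : ℂ)⁻¹) * X) * fallingTruncation f m +
    C (B : ℂ) * X * fallingTruncation f₁ m with hR
  have hRe : ∀ (m : ℕ) (w : ℂ), (R m).eval w =
      A * (1 - (m : ℂ)⁻¹ * w) * (fallingTruncation f m).eval w +
        B * w * (fallingTruncation f₁ m).eval w := by
    intro m w
    simp [hR]
  have hRm : ∀ {m : ℕ}, m ≠ 0 → ∀ {w : ℂ}, w ≠ m →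
      aeval (w / (m - w)) (eulerOp f ((X + C 1) ^ m * (C A + C (m * B) * X))) =
        (m / (m - w)) ^ m * (m / (m - w)) * (R m).eval w := by
    intro m hm w hw
    have hm' : (m : ℂ) ≠ 0 := Nat.cast_ne_zero.2 hm
    have hw' : (m : ℂ) - w ≠ 0 := sub_ne_zero.2 hw.symm
    rw [htest, hRe]
    simp only [map_add, map_mul, aeval_X, aeval_C, aeval_eulerOp_one_add_X_pow _ hm hw,
      Complex.coe_algebraMap]
    push_cast
    field_simp
  have hne : ∀ {m : ℕ} {w : ℂ}, 0 < w.im → w ≠ m := by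
    rintro m w hw rfl
    simp at hw
  have hzero := tendsto_eval_eq_zero_of_zeroFree_ball (l := Filter.atTop) (p := R)
    (N := max (1 + f.natDegree) (1 + f₁.natDegree)) (z₀ := u) (ρ := u.im)
    (g := fun w => A * aeval w f + B * w * aeval w f₁) ?_ hu ?_ ?_ h0
  · have hpoly : C A * f + C B * X * f₁ = 0 := by
      refine map_injective Complex.ofRealHom Complex.ofReal_injective ?_
      refine Polynomial.funext fun w => ?_
      rw [Polynomial.map_zero, eval_zero, ← hzero w, eval_map]
      simp [aeval_def, eval₂_add, eval₂_mul]
      rfl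
    have hB : B = 0 := by
      by_contra hB
      have h1 := congrArg (fun p => p.coeff (f.natDegree + 1)) hpoly
      simp only [hf₁, coeff_add, coeff_C_mul, mul_assoc, coeff_X_mul, coeff_zero,
        coeff_natDegree, coeff_derivative, coeff_eq_zero_of_natDegree_lt (Nat.lt_succ_self _),
        mul_zero, zero_add, zero_mul, add_zero] at h1
      exact mul_ne_zero hB (leadingCoeff_ne_zero.2 hf) h1
    have hA : A ≠ 0 := hAB.resolve_right (not_not.2 hB)
    rw [hB] at hpoly
    simp [hA, hf] at hpoly
  · intro m
    refine (natDegree_add_le _ _).trans (max_le_max ?_ ?_)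
    · refine natDegree_mul_le.trans (add_le_add ?_ (natDegree_fallingTruncation_le f m))
      compute_degree
    · refine natDegree_mul_le.trans (add_le_add ?_ (natDegree_fallingTruncation_le f₁ m))
      compute_degree
  · filter_upwards [Filter.eventually_ge_atTop 1] with m hm
    have hm0 : m ≠ 0 := Nat.one_le_iff_ne_zero.1 hm
    have hmpos : (0 : ℝ) < m := by exact_mod_cast hm
    have hm' : (m : ℂ) ≠ 0 := Nat.cast_ne_zero.2 hm0
    have hq : ∀ z : ℂ, 0 < z.im → aeval z ((X + C 1) ^ m * (C A + C (m * B) * X)) ≠ 0 := by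
      intro z hz
      simp only [map_mul, map_pow, map_add, aeval_X, aeval_C, Complex.coe_algebraMap]
      refine mul_ne_zero (pow_ne_zero _ fun h => ?_) fun h => ?_
      · have := congrArg Complex.im h
        simp only [Complex.add_im, Complex.ofReal_im, add_zero, Complex.zero_im] at this
        exact hz.ne' this
      · rw [← Complex.ofReal_mul] at h
        have him := congrArg Complex.im h
        have hre := congrArg Complex.re h
        simp only [Complex.add_im, Complex.ofReal_im, Complex.im_ofReal_mul, Complex.zero_im,
          zero_add, Complex.add_re, Complex.ofReal_re, Complex.re_ofReal_mul, Complex.zero_re]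
          at him hre
        have hB : B = 0 := by
          rcases mul_eq_zero.1 him with h5 | h5
          · exact (mul_eq_zero.1 h5).resolve_left hmpos.ne'
          · exact absurd h5 hz.ne'
        rw [hB] at hre
        simp only [mul_zero, zero_mul, add_zero] at hre
        exact hAB.elim (fun h => h hre) fun h => h hB
    rcases hU _ hq with h1 | h1
    · left
      intro w hw hw0
      have hwim : 0 < w.im := by
        rw [Metric.mem_ball, dist_eq_norm] at hw
        have := (Complex.abs_im_le_norm (w - u)).trans_lt hw
        rw [Complex.sub_im, abs_lt] at this
        linarith
      refine h1 (w / (m - w)) ?_ ?_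
      · have hw' : (m : ℂ) - w ≠ 0 := sub_ne_zero.2 (hne hwim).symm
        have h2 : w / (m - w) = (m : ℝ) * ((m : ℂ) - w)⁻¹ - 1 := by
          push_cast
          field_simp
          ring
        rw [h2, Complex.sub_im, Complex.im_ofReal_mul, Complex.inv_im]
        have h3 : 0 < Complex.normSq ((m : ℂ) - w) := Complex.normSq_pos.2 hw'
        simp only [Complex.sub_im, Complex.natCast_im, zero_sub, neg_neg, Complex.one_im, sub_zero]
        positivity
      · rw [hRm hm0 (hne hwim), hw0, mul_zero]
    · right
      refine eq_zero_of_infinite_isRoot _ ((Set.finite_singleton (m : ℂ)).infinite_compl.mono ?_)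
      intro w hw
      have hw0 := hRm hm0 (w := w) hw
      rw [h1, map_zero] at hw0
      have hw' : (m : ℂ) - w ≠ 0 := sub_ne_zero.2 (Ne.symm hw)
      have h4 : (m : ℂ) / (m - w) ≠ 0 := div_ne_zero hm' hw'
      exact (mul_eq_zero.1 hw0.symm).resolve_left (mul_ne_zero (pow_ne_zero _ h4) h4)
  · intro w
    simp only [hRe]
    have h6 : Filter.Tendsto (fun m : ℕ => ((m : ℂ)⁻¹)) Filter.atTop (nhds 0) :=
      tendsto_inv_atTop_nhds_zero_nat
    have h7 : Filter.Tendsto (fun m : ℕ => (A : ℂ) * (1 - (m : ℂ)⁻¹ * w)) Filter.atTop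
        (nhds (A * (1 - 0 * w))) := ((h6.mul_const w).const_sub 1).const_mul _
    simpa using (h7.mul (tendsto_eval_fallingTruncation f w)).add
      ((tendsto_eval_fallingTruncation f₁ w).const_mul (B * w))

/-- The function `ρ y² / ((r - ρ)² + y²)` of `y`. For `ρ = r` it is set to its value `ρ` at `y ≠ 0`,
so that it is continuous at `y = 0` as well. -/
noncomputable def poissonWeight (r ρ y : ℝ) : ℝ :=
  if ρ = r then ρ else ρ * (y ^ 2 / ((r - ρ) ^ 2 + y ^ 2))

lemma continuous_poissonWeight (r ρ : ℝ) : Continuous (poissonWeight r ρ) := by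
  unfold poissonWeight
  split_ifs with h
  · exact continuous_const
  · have h1 : 0 < (r - ρ) ^ 2 := by
      have : r - ρ ≠ 0 := sub_ne_zero.2 (Ne.symm h)
      positivity
    refine continuous_const.mul (Continuous.div (by fun_prop) (by fun_prop) fun y => ?_)
    positivity

lemma poissonWeight_le_abs (r ρ y : ℝ) : poissonWeight r ρ y ≤ |ρ| := by
  unfold poissonWeight
  split_ifs with h
  · exact le_abs_self ρ
  · refine (le_abs_self _).trans ?_
    rw [abs_mul]
    refine mul_le_of_le_one_right (abs_nonneg ρ) ?_
    rw [abs_of_nonneg (by positivity)]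
    exact div_le_one_of_le₀ (by nlinarith [sq_nonneg (r - ρ)]) (by positivity)

lemma mul_im_mul_one_div {r y : ℝ} (hy : 0 < y) (ρ : ℂ) (hρ : ρ.im = 0) :
    y * (((r : ℂ) + y * Complex.I) * (1 / ((r : ℂ) + y * Complex.I - ρ))).im =
      -poissonWeight r ρ.re y := by
  have hρ' : ρ = (ρ.re : ℂ) := Complex.ext (by simp) (by simp [hρ])
  have hpos : 0 < (r - ρ.re) ^ 2 + y ^ 2 := by positivity
  have hw : poissonWeight r ρ.re y = ρ.re * (y ^ 2 / ((r - ρ.re) ^ 2 + y ^ 2)) := by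
    unfold poissonWeight
    split_ifs with h
    · rw [h]
      field_simp
      ring
    · rfl
  rw [hw, one_div, Complex.mul_im, Complex.inv_im, Complex.inv_re, Complex.normSq_apply]
  simp [hρ]
  have h2 : (r - ρ.re) * (r - ρ.re) + y * y ≠ 0 := by nlinarith
  field_simp
  ring

lemma mul_im_mul_sum_one_div {r y : ℝ} (hy : 0 < y) (s : Multiset ℂ) (hs : ∀ ρ ∈ s, ρ.im = 0) :
    y * (((r : ℂ) + y * Complex.I) *
      (s.map fun ρ => 1 / ((r : ℂ) + y * Complex.I - ρ)).sum).im =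
      -(s.map fun ρ => poissonWeight r ρ.re y).sum := by
  induction s using Multiset.induction_on with
  | empty => simp
  | cons a s ih =>
    rw [Multiset.map_cons, Multiset.sum_cons, Multiset.map_cons, Multiset.sum_cons, mul_add,
      Complex.add_im, mul_add, ih fun ρ hρ => hs ρ (Multiset.mem_cons_of_mem hρ),
      mul_im_mul_one_div hy a (hs a (Multiset.mem_cons_self a s))]
    ring

/-- At height `y` above a positive zero `r` of `f`, the number `z + z f'(z) / f(z)` has imaginary
part `y⁻¹ (y² - ∑ρ w(ρ, y))`, with the weights `w` of `poissonWeight`. This is negative for small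
`y` and positive for large `y`, so it vanishes at some `z`; there `A f + z (f + f')` is zero for a
real `A`. -/
lemma hasOnlyRealNonposZeros_of_eulerOp {f : ℝ[X]} (hf : f ≠ 0)
    (hU : ∀ q : ℝ[X], (∀ z : ℂ, 0 < z.im → aeval z q ≠ 0) →
      (∀ z : ℂ, 0 < z.im → aeval z (eulerOp f q) ≠ 0) ∨ eulerOp f q = 0) :
    HasOnlyRealNonposZeros f := by
  have hup : ∀ x : ℂ, 0 < x.im → aeval x f ≠ 0 := by
    intro x hx
    simpa using mul_aeval_add_ne_zero hf hU (A := 1) (B := 0) (Or.inl one_ne_zero) hx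
  have hreal : ∀ x : ℂ, aeval x f = 0 → x.im = 0 := by
    intro x hx
    rcases lt_trichotomy x.im 0 with h | h | h
    · refine absurd ?_ (hup (starRingEnd ℂ x) (by simpa using h))
      rw [aeval_conj, hx, map_zero]
    · exact h
    · exact absurd hx (hup x h)
  refine ⟨hf, fun x hx => ⟨hreal x hx, ?_⟩⟩
  by_contra! hxpos
  set r := x.re with hr
  set p : ℂ[X] := f.map Complex.ofRealHom with hp
  have hpe : ∀ z, p.eval z = aeval z f := fun z => eval_map _ _
  have hp0 : p ≠ 0 := by
    rw [hp, Ne, Polynomial.map_eq_zero]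
    exact hf
  have hroots : ∀ ρ ∈ p.roots, ρ.im = 0 := by
    intro ρ hρ
    refine hreal ρ ?_
    rw [← hpe]
    exact isRoot_of_mem_roots hρ
  have hxr : x ∈ p.roots := by
    rw [mem_roots hp0, IsRoot, hpe, hx]
  set Φ : ℝ → ℝ := fun y => (p.roots.map fun ρ => poissonWeight r ρ.re y).sum with hΦ
  have hcont : Continuous Φ :=
    continuous_multiset_sum _ fun ρ _ => continuous_poissonWeight r ρ.re
  have hΦ0 : 0 < Φ 0 := by
    have hnn : ∀ a ∈ p.roots.map (fun ρ => poissonWeight r ρ.re 0), 0 ≤ a := by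
      intro a ha
      obtain ⟨ρ, -, rfl⟩ := Multiset.mem_map.1 ha
      unfold poissonWeight
      split_ifs with h
      · rw [h]; exact hxpos.le
      · simp
    have hle := Multiset.single_le_sum hnn _ (Multiset.mem_map_of_mem _ hxr)
    refine lt_of_lt_of_le ?_ hle
    simpa [poissonWeight, hr] using hxpos
  set K := (p.roots.map fun ρ => |ρ.re|).sum with hK
  have hΦK : ∀ y, Φ y ≤ K := fun y =>
    Multiset.sum_map_le_sum_map _ _ fun ρ _ => poissonWeight_le_abs r ρ.re y
  have hK0 : 0 ≤ K := hΦ0.le.trans (hΦK 0)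
  obtain ⟨y, hy, hyeq⟩ : ∃ y ∈ Set.Icc 0 (K + 1), y ^ 2 - Φ y = 0 := by
    have hivt := intermediate_value_Icc (f := fun y => y ^ 2 - Φ y) (a := 0) (b := K + 1)
      (by linarith) (by fun_prop)
    refine hivt ⟨?_, ?_⟩
    · simp only [ne_eq, OfNat.ofNat_ne_zero, not_false_eq_true, zero_pow, zero_sub]
      linarith
    · have := hΦK (K + 1)
      nlinarith
  have hypos : 0 < y := by
    refine lt_of_le_of_ne hy.1 ?_
    rintro rfl
    norm_num at hyeq
    exact hΦ0.ne' hyeq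
  set z : ℂ := (r : ℂ) + y * Complex.I with hz
  have hzim : z.im = y := by simp [hz]
  have hzpos : 0 < z.im := hzim ▸ hypos
  have hfz : p.eval z ≠ 0 := by
    rw [hpe]
    exact hup z hzpos
  have hder := (IsAlgClosed.splits p).eval_derivative_eq_eval_mul_sum hfz
  set q := (p.roots.map fun ρ => 1 / (z - ρ)).sum with hq
  have hzq : y * (z * q).im = -Φ y := mul_im_mul_sum_one_div hypos p.roots hroots
  have him : (z + z * q).im = 0 := by
    have : y * (z + z * q).im = 0 := by
      rw [Complex.add_im, mul_add, hzq, hzim]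
      linarith
    exact (mul_eq_zero.1 this).resolve_left hypos.ne'
  refine mul_aeval_add_ne_zero hf hU (A := -(z + z * q).re) (B := 1) (Or.inr one_ne_zero) hzpos ?_
  have hzr : z + z * q = ((z + z * q).re : ℂ) := Complex.ext (by simp) (by simp [him])
  have hfd : aeval z (derivative f) = aeval z f * q := by
    rw [← hpe z, ← hder, hp, derivative_map, eval_map]
    rfl
  rw [map_add, hfd, Complex.ofReal_neg, ← hzr]
  push_cast
  ring

end

section

open MvPolynomial

/-! ### Necessity: the eigenvalues have rank one -/

/-- A stable polynomial `a + b x + c y + d x y` with real coefficients satisfies `a d ≤ b c`. -/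
lemma mul_le_mul_of_forall_ne_zero {a b c d : ℝ}
    (h : ∀ x y : ℂ, 0 < x.im → 0 < y.im → (a + b * x + c * y + d * (x * y) : ℂ) ≠ 0) :
    a * d ≤ b * c := by
  by_contra! hlt
  have hden : 0 < c ^ 2 + d ^ 2 := by
    rcases eq_or_ne c 0 with hc | hc
    · have hd : d ≠ 0 := by
        rintro rfl
        simp [hc] at hlt
      positivity
    · positivity
  have hne : (c + d * Complex.I : ℂ) ≠ 0 := by
    intro h0
    have h1 := congrArg Complex.re h0
    have h2 := congrArg Complex.im h0
    simp at h1 h2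
    simp [h1, h2] at hden
  -- the zero in `y` of the bilinear polynomial at `x = i`
  refine h Complex.I (-(a + b * Complex.I) / (c + d * Complex.I)) (by simp) ?_ ?_
  · rw [Complex.div_im]
    simp only [Complex.normSq_apply]
    simp
    have h3 : 0 < c * c + d * d := by nlinarith
    exact div_lt_div_of_pos_right (neg_lt_neg hlt) h3
  · linear_combination div_mul_cancel₀ (-(a + b * Complex.I : ℂ)) hne

lemma mul_le_mul_of_forall_eq_zero {a b c d : ℝ}
    (h : ∀ x y : ℂ, 0 < x.im → 0 < y.im → (a + b * x + c * y + d * (x * y) : ℂ) = 0) :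
    a * d ≤ b * c := by
  have h1 := h Complex.I Complex.I (by simp) (by simp)
  have h2 := h (2 * Complex.I) Complex.I (by simp) (by simp)
  have h3 := congrArg Complex.im h1
  have h4 := congrArg Complex.im h2
  have h5 := congrArg Complex.re h1
  have h6 := congrArg Complex.re h2
  simp at h3 h4 h5 h6
  have hb : b = 0 := by linarith
  have hd : d = 0 := by linarith
  simp [hb, hd]

lemma ne_zero_of_im_pos {z : ℂ} (h : 0 < z.im) : z ≠ 0 := by
  rintro rfl
  simp at h

lemma one_add_mul_ne_zero {z : ℂ} (h : 0 < z.im) {ε : ℝ} : (1 + ε * z : ℂ) ≠ 0 := by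
  intro h0
  have h1 := congrArg Complex.im h0
  simp at h1
  rcases h1 with h1 | h1
  · simp [h1] at h0
  · exact h.ne' h1

lemma eval_monomial_ne_zero {n : ℕ} (α : Fin n →₀ ℕ) {z : Fin n → ℂ} (hz : ∀ j, 0 < (z j).im) :
    eval z (monomial α (1 : ℂ)) ≠ 0 := by
  rw [eval_monomial, one_mul]
  exact Finset.prod_ne_zero_iff.2 fun i _ => pow_ne_zero _ (ne_zero_of_im_pos (hz i))

/-- The inequality that results from applying a diagonal stability preserver to
`z^α (1 + zᵢ) (1 + ε zⱼ)`. -/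
lemma mul_le_mul_of_preserver {n : ℕ} {lam : (Fin n → ℕ) → ℝ}
    (hT : ∀ f, IsRealStable f → IsRealStable (diagonalOp lam f) ∨ diagonalOp lam f = 0)
    (α : Fin n →₀ ℕ) {i j : Fin n} (hij : i ≠ j) (ε : ℝ) :
    lam α * (ε * lam (α + (Finsupp.single i 1 + Finsupp.single j 1) : Fin n →₀ ℕ)) ≤
      lam (α + Finsupp.single i 1 : Fin n →₀ ℕ) * (ε * lam (α + Finsupp.single j 1 : Fin n →₀ ℕ)) := by
  set q : MvPolynomial (Fin n) ℝ := monomial α 1 + monomial (α + Finsupp.single i 1) 1 +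
    monomial (α + Finsupp.single j 1) ε +
    monomial (α + (Finsupp.single i 1 + Finsupp.single j 1)) ε with hq
  have hsplit : ∀ (z : Fin n → ℂ) (β : Fin n →₀ ℕ) (c : ℂ),
      eval z (monomial (α + β) c) = eval z (monomial α 1) * eval z (monomial β c) := by
    intro z β c
    rw [← map_mul, monomial_mul, one_mul]
  have hlin : ∀ (z : Fin n → ℂ) (k : Fin n) (c : ℂ),
      eval z (monomial (Finsupp.single k 1) c) = c * z k := by
    intro z k c
    simp [eval_monomial]
  have hbil : ∀ (z : Fin n → ℂ) (c : ℂ),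
      eval z (monomial (Finsupp.single i 1 + Finsupp.single j 1) c) = c * (z i * z j) := by
    intro z c
    rw [← mul_one c, ← monomial_mul, map_mul, hlin, hlin]
    ring
  have hstab : IsRealStable (map Complex.ofRealHom q) := by
    refine ⟨fun z hz => ?_, hasRealCoeffs_map q⟩
    have : eval z (map Complex.ofRealHom q) =
        eval z (monomial α 1) * ((1 + (1 : ℝ) * z i) * (1 + ε * z j)) := by
      simp only [hq, map_add, map_monomial, hsplit, Complex.ofRealHom_eq_coe, Complex.ofReal_one,
        hlin, hbil]
      ring
    rw [this]
    exact mul_ne_zero (eval_monomial_ne_zero α hz)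
      (mul_ne_zero (one_add_mul_ne_zero (hz i)) (one_add_mul_ne_zero (hz j)))
  have hTq : ∀ z : Fin n → ℂ, eval z (diagonalOp lam (map Complex.ofRealHom q)) =
      eval z (monomial α 1) * (lam α + lam (α + Finsupp.single i 1 : Fin n →₀ ℕ) * z i +
        (ε * lam (α + Finsupp.single j 1 : Fin n →₀ ℕ) : ℝ) * z j +
        (ε * lam (α + (Finsupp.single i 1 + Finsupp.single j 1) : Fin n →₀ ℕ) : ℝ) * (z i * z j)) := by
    intro z
    simp only [hq, map_add, map_monomial, diagonalOp_monomial, hsplit, Complex.ofRealHom_eq_coe,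
      Complex.ofReal_one, mul_one, hlin, hbil]
    rw [← mul_one (lam α : ℂ), ← smul_eq_mul, ← smul_monomial, smul_eval]
    push_cast
    ring
  have hxy : ∀ x y : ℂ, 0 < x.im → 0 < y.im → ∃ z : Fin n → ℂ, (∀ k, 0 < (z k).im) ∧ z i = x ∧
      z j = y := by
    intro x y hx hy
    refine ⟨Function.update (fun _ => y) i x, fun k => ?_, by simp, by simp [hij.symm]⟩
    by_cases hk : k = i
    · subst hk; simpa using hx
    · simpa [hk] using hy
  rcases hT _ hstab with h1 | h1
  · refine mul_le_mul_of_forall_ne_zero fun x y hx hy h0 => ?_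
    obtain ⟨z, hz, rfl, rfl⟩ := hxy x y hx hy
    exact h1.1 z hz (by rw [hTq, h0, mul_zero])
  · refine mul_le_mul_of_forall_eq_zero fun x y hx hy => ?_
    obtain ⟨z, hz, rfl, rfl⟩ := hxy x y hx hy
    have h2 := hTq z
    rw [h1, map_zero] at h2
    exact (mul_eq_zero.1 h2.symm).resolve_left (eval_monomial_ne_zero α hz)

/-- The inequalities for `ε = 1` and `ε = -1` are opposite to each other. -/
lemma mul_eq_mul_of_preserver {n : ℕ} {lam : (Fin n → ℕ) → ℝ}
    (hT : ∀ f, IsRealStable f → IsRealStable (diagonalOp lam f) ∨ diagonalOp lam f = 0)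
    (α : Fin n →₀ ℕ) {i j : Fin n} (hij : i ≠ j) :
    lam α * lam (α + (Finsupp.single i 1 + Finsupp.single j 1) : Fin n →₀ ℕ) =
      lam (α + Finsupp.single i 1 : Fin n →₀ ℕ) * lam (α + Finsupp.single j 1 : Fin n →₀ ℕ) := by
  have h1 := mul_le_mul_of_preserver hT α hij 1
  have h2 := mul_le_mul_of_preserver hT α hij (-1)
  linarith

/-- The polynomial in `α` that gives the eigenvalues of a diagonal differential operator. -/
noncomputable def eigenvaluePoly {n : ℕ} (S : Finset (Fin n ⊕ Fin n →₀ ℕ))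
    (g : (Fin n ⊕ Fin n →₀ ℕ) → ℝ) : MvPolynomial (Fin n) ℝ :=
  ∑ m ∈ S, C (g m) * ∏ i, Polynomial.aeval (X i) (descPochhammer ℝ (m (Sum.inr i)))

lemma eval_natCast_eigenvaluePoly {n : ℕ} (S : Finset (Fin n ⊕ Fin n →₀ ℕ))
    (g : (Fin n ⊕ Fin n →₀ ℕ) → ℝ) (α : Fin n → ℕ) :
    eval (fun i => (α i : ℝ)) (eigenvaluePoly S g) =
      ∑ m ∈ S, g m * ∏ i, ((α i).descFactorial (m (Sum.inr i)) : ℝ) := by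
  have h : ∀ (i : Fin n) (q : Polynomial ℝ),
      eval (fun i => (α i : ℝ)) (Polynomial.aeval (X i) q) = q.eval (α i : ℝ) := by
    intro i q
    rw [Polynomial.aeval_def, Polynomial.hom_eval₂, eval_X, Polynomial.eval₂_eq_eval_map]
    congr 1
    rw [show (eval fun i => (α i : ℝ)).comp (algebraMap ℝ (MvPolynomial (Fin n) ℝ)) = RingHom.id ℝ
      from RingHom.ext fun r => eval_C r, Polynomial.map_id]
  simp only [eigenvaluePoly, map_sum, map_mul, eval_C, map_prod, h,
    descPochhammer_eval_eq_descFactorial]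

lemma eval_aeval_eq_eval {σ τ : Type*} (φ : σ → MvPolynomial τ ℝ) (x : τ → ℝ)
    (P : MvPolynomial σ ℝ) : eval x (aeval φ P) = eval (fun k => eval x (φ k)) P := by
  induction P using MvPolynomial.induction_on with
  | C c => simp [algebraMap_eq]
  | add p q hp hq => simp only [map_add, hp, hq]
  | mul_X p i hp => rw [map_mul, map_mul, hp, map_mul, aeval_X, eval_X]

/-- The translate `P(x + v)` of a polynomial. -/
noncomputable def shiftPoly {n : ℕ} (v : Fin n → ℕ) :
    MvPolynomial (Fin n) ℝ →ₐ[ℝ] MvPolynomial (Fin n) ℝ :=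
  aeval fun i => X i + C (v i : ℝ)

lemma eval_shiftPoly {n : ℕ} (v : Fin n → ℕ) (x : Fin n → ℝ) (P : MvPolynomial (Fin n) ℝ) :
    eval x (shiftPoly v P) = eval (fun i => x i + v i) P := by
  rw [shiftPoly, eval_aeval_eq_eval]
  simp

lemma shiftPoly_zero {n : ℕ} (P : MvPolynomial (Fin n) ℝ) : shiftPoly 0 P = P := by
  refine MvPolynomial.funext fun x => ?_
  simp [eval_shiftPoly]

lemma shiftPoly_shiftPoly {n : ℕ} (v w : Fin n → ℕ) (P : MvPolynomial (Fin n) ℝ) :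
    shiftPoly v (shiftPoly w P) = shiftPoly (v + w) P := by
  refine MvPolynomial.funext fun x => ?_
  simp only [eval_shiftPoly, Pi.add_apply, Nat.cast_add, add_assoc]

lemma shiftPoly_ne_zero {n : ℕ} (v : Fin n → ℕ) {P : MvPolynomial (Fin n) ℝ} (hP : P ≠ 0) :
    shiftPoly v P ≠ 0 := by
  intro h
  refine hP (MvPolynomial.funext fun x => ?_)
  have h1 := congrArg (eval fun i => x i - v i) h
  rw [eval_shiftPoly] at h1
  simpa using h1

/-- The identity `P(x) P(x + v + w) = P(x + v) P(x + w)`: the values of `P` on the lattice spanned by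
the shifts `v` and `w` have vanishing `2 × 2` minors. -/
def RankOne {n : ℕ} (P : MvPolynomial (Fin n) ℝ) (v w : Fin n → ℕ) : Prop :=
  P * shiftPoly (v + w) P = shiftPoly v P * shiftPoly w P

lemma RankOne.symm {n : ℕ} {P : MvPolynomial (Fin n) ℝ} {v w : Fin n → ℕ} (h : RankOne P v w) :
    RankOne P w v := by
  rw [RankOne] at *
  rw [add_comm w, h, mul_comm]

/-- For fixed `w`, the shifts `v` with `RankOne P v w` form a submonoid. Closure under addition needs
a cancellation of `P(x + v)`, which is possible for polynomials although `P` may have zeros in the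
lattice. -/
def rankOneSubmonoid {n : ℕ} (P : MvPolynomial (Fin n) ℝ) (hP : P ≠ 0) (w : Fin n → ℕ) :
    AddSubmonoid (Fin n → ℕ) where
  carrier := {v | RankOne P v w}
  zero_mem' := by
    show P * shiftPoly (0 + w) P = shiftPoly 0 P * shiftPoly w P
    rw [zero_add, shiftPoly_zero]
  add_mem' := by
    intro v u hv hu
    have h1 : P * shiftPoly (v + w) P = shiftPoly v P * shiftPoly w P := hv
    have h2 : P * shiftPoly (u + w) P = shiftPoly u P * shiftPoly w P := hu
    have h3 := congrArg (shiftPoly v) h2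
    rw [map_mul, map_mul, shiftPoly_shiftPoly, shiftPoly_shiftPoly, shiftPoly_shiftPoly] at h3
    show P * shiftPoly (v + u + w) P = shiftPoly (v + u) P * shiftPoly w P
    refine mul_left_cancel₀ (shiftPoly_ne_zero v hP) ?_
    rw [add_assoc]
    linear_combination P * h3 + shiftPoly (v + u) P * h1

lemma mem_of_single_mem {n : ℕ} (M : AddSubmonoid (Fin n → ℕ)) {v : Fin n → ℕ}
    (h : ∀ i, v i ≠ 0 → Pi.single i 1 ∈ M) : v ∈ M := by
  have hv : v = ∑ i, v i • (Pi.single i 1 : Fin n → ℕ) := by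
    ext k
    simp [Finset.sum_apply, Pi.single_apply]
  rw [hv]
  refine M.sum_mem fun i _ => ?_
  by_cases hi : v i = 0
  · rw [hi, zero_smul]
    exact M.zero_mem
  · exact M.nsmul_mem (h i hi) _

lemma rankOne_of_disjoint {n : ℕ} {P : MvPolynomial (Fin n) ℝ} (hP : P ≠ 0)
    (h : ∀ i j, i ≠ j → RankOne P (Pi.single i 1) (Pi.single j 1)) {v w : Fin n → ℕ}
    (hvw : ∀ i, v i = 0 ∨ w i = 0) : RankOne P v w := by
  refine mem_of_single_mem (rankOneSubmonoid P hP w) fun i hi => RankOne.symm ?_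
  refine mem_of_single_mem (rankOneSubmonoid P hP (Pi.single i 1)) fun j hj => h j i ?_
  rintro rfl
  exact (hvw j).elim hi hj

/-- A polynomial that is of rank one in any two coordinate directions is a product of polynomials
in one variable: up to constants, of its restrictions to the coordinate lines through a point `b`
with `P(b) ≠ 0`. -/
lemma eval_mul_pow_eq_prod {n : ℕ} {P : MvPolynomial (Fin n) ℝ} (hP : P ≠ 0)
    (h : ∀ i j, i ≠ j → RankOne P (Pi.single i 1) (Pi.single j 1)) (b x : Fin n → ℝ) :
    eval x P * eval b P ^ n = eval b P * ∏ i, eval (Function.update b i (x i)) P := by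
  have hstep : ∀ (v : Fin n → ℕ) (s : Finset (Fin n)),
      eval (fun k => b k + if k ∈ s then (v k : ℝ) else 0) P * eval b P ^ s.card =
        eval b P * ∏ i ∈ s, eval (Function.update b i (b i + v i)) P := by
    intro v s
    induction s using Finset.induction_on with
    | empty => simp
    | insert i s his ih =>
      have hr : RankOne P (fun k => if k ∈ s then v k else 0) (Pi.single i (v i)) := by
        refine rankOne_of_disjoint hP h fun k => ?_
        by_cases hk : k = i
        · subst hk; simp [his]
        · simp [hk]
      have hr' := congrArg (eval b) hr
      rw [map_mul, map_mul, eval_shiftPoly, eval_shiftPoly, eval_shiftPoly] at hr'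
      have e1 : (fun k => b k + (((fun k => if k ∈ s then v k else 0) + Pi.single i (v i) :
          Fin n → ℕ) k : ℝ)) = fun k => b k + if k ∈ insert i s then (v k : ℝ) else 0 := by
        ext k
        by_cases hk : k = i
        · subst hk; simp [his]
        · simp [hk]
      have e2 : (fun k => b k + ((Pi.single i (v i) : Fin n → ℕ) k : ℝ)) =
          Function.update b i (b i + v i) := by
        ext k
        by_cases hk : k = i
        · subst hk; simp
        · simp [hk]
      have e3 : (fun k => b k + ((if k ∈ s then v k else 0 : ℕ) : ℝ)) =
          fun k => b k + if k ∈ s then (v k : ℝ) else 0 := by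
        ext k
        split_ifs <;> simp
      rw [e1, e2, e3] at hr'
      rw [Finset.card_insert_of_notMem his, Finset.prod_insert his, pow_succ]
      linear_combination eval b P ^ s.card * hr' +
        eval (Function.update b i (b i + v i)) P * ih
  have hsub : ∀ (y : Fin n → ℝ) (i : Fin n),
      eval y (aeval (fun k => if k = i then X i else C (b k)) P) =
        eval (Function.update b i (y i)) P := by
    intro y i
    rw [eval_aeval_eq_eval]
    congr 2
    ext k
    by_cases hk : k = i
    · subst hk; simp
    · simp [hk]
  -- both sides are polynomials in `x`, and they agree on `b + ℕⁿ`
  have hpoly : P * C (eval b P ^ n) = C (eval b P) *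
      ∏ i, aeval (fun k => if k = i then X i else C (b k)) P := by
    refine MvPolynomial.funext_set (fun i => Set.range fun v : ℕ => b i + v) (fun i => ?_) ?_
    · exact Set.infinite_range_of_injective fun u v huv => by simpa using huv
    · intro y hy
      choose v hv using fun i => hy i (Set.mem_univ i)
      have hy' : y = fun k => b k + (v k : ℝ) := _root_.funext fun k => (hv k).symm
      have h1 := hstep v Finset.univ
      simp only [Finset.mem_univ, if_true, Finset.card_univ, Fintype.card_fin, ← hy'] at h1
      rw [map_mul, eval_C, h1, map_mul, eval_C, map_prod]
      congr 1
      refine Finset.prod_congr rfl fun i _ => ?_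
      rw [hsub, hy']
  have h2 := congrArg (eval x) hpoly
  simpa only [map_mul, eval_C, map_prod, hsub] using h2

lemma rankOne_eigenvaluePoly {n : ℕ} {lam : (Fin n → ℕ) → ℝ}
    (hT : ∀ f, IsRealStable f → IsRealStable (diagonalOp lam f) ∨ diagonalOp lam f = 0)
    {P : MvPolynomial (Fin n) ℝ} (hP : ∀ α, eval (fun i => (α i : ℝ)) P = lam α) {i j : Fin n}
    (hij : i ≠ j) : RankOne P (Pi.single i 1) (Pi.single j 1) := by
  have hshift : ∀ v α : Fin n → ℕ, eval (fun k => (α k : ℝ)) (shiftPoly v P) = lam (α + v) := by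
    intro v α
    rw [eval_shiftPoly, ← hP]
    simp
  refine MvPolynomial.funext_set (fun _ => Set.range fun k : ℕ => (k : ℝ))
    (fun _ => Set.infinite_range_of_injective Nat.cast_injective) fun y hy => ?_
  choose α hα using fun k => hy k (Set.mem_univ k)
  obtain rfl : (fun k => (α k : ℝ)) = y := _root_.funext hα
  have h := mul_eq_mul_of_preserver hT (Finsupp.equivFunOnFinite.symm α) hij
  rw [map_mul, map_mul, hP, hshift, hshift, hshift]
  simpa [Finsupp.single_eq_pi_single] using h

/-! ### Necessity: reduction to one variable -/

/-- The polynomial `z^β q(zᵢ)`. -/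
noncomputable def embedVar {n : ℕ} (β : Fin n →₀ ℕ) (i : Fin n) (q : Polynomial ℝ) :
    MvPolynomial (Fin n) ℂ :=
  map Complex.ofRealHom (monomial β 1 * Polynomial.aeval (X i) q)

lemma embedVar_add {n : ℕ} (β : Fin n →₀ ℕ) (i : Fin n) (p q : Polynomial ℝ) :
    embedVar β i (p + q) = embedVar β i p + embedVar β i q := by
  simp only [embedVar, map_add, mul_add]

lemma embedVar_monomial {n : ℕ} (β : Fin n →₀ ℕ) (i : Fin n) (k : ℕ) (c : ℝ) :
    embedVar β i (Polynomial.monomial k c) = monomial (β + Finsupp.single i k) (c : ℂ) := by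
  rw [embedVar, Polynomial.aeval_monomial, algebraMap_eq, C_mul_X_pow_eq_monomial, monomial_mul,
    one_mul, map_monomial]
  rfl

lemma eval_embedVar {n : ℕ} (β : Fin n →₀ ℕ) (i : Fin n) (q : Polynomial ℝ) (z : Fin n → ℂ) :
    eval z (embedVar β i q) = eval z (monomial β 1) * Polynomial.aeval (z i) q := by
  induction q using Polynomial.induction_on' with
  | add p q hp hq => rw [embedVar_add, map_add, hp, hq, map_add, mul_add]
  | monomial k c =>
    have h : (monomial (β + Finsupp.single i k) (c : ℂ)) =
        monomial β 1 * monomial (Finsupp.single i k) (c : ℂ) := by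
      rw [monomial_mul, one_mul]
    rw [embedVar_monomial, h, map_mul, Polynomial.aeval_monomial]
    congr 1
    simp [eval_monomial]

lemma diagonalOp_embedVar {n : ℕ} {lam : (Fin n → ℕ) → ℝ} {β : Fin n →₀ ℕ} {i : Fin n}
    {f : Polynomial ℝ}
    (hf : ∀ k, fallingEval f k = lam (β + Finsupp.single i k : Fin n →₀ ℕ)) (q : Polynomial ℝ) :
    diagonalOp lam (embedVar β i q) = embedVar β i (eulerOp f q) := by
  induction q using Polynomial.induction_on' with
  | add p q hp hq => rw [embedVar_add, map_add, hp, hq, eulerOp_add, embedVar_add]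
  | monomial k c =>
    have h : eulerOp f (Polynomial.monomial k c) = Polynomial.monomial k (fallingEval f k * c) := by
      ext l
      rw [coeff_eulerOp, Polynomial.coeff_monomial, Polynomial.coeff_monomial]
      split_ifs with hkl
      · rw [hkl]
      · rw [mul_zero]
    rw [h, embedVar_monomial, embedVar_monomial, diagonalOp_monomial, hf, Complex.ofReal_mul]

lemma hasOnlyRealNonposZeros_of_preserver {n : ℕ} {lam : (Fin n → ℕ) → ℝ}
    (hT : ∀ f, IsRealStable f → IsRealStable (diagonalOp lam f) ∨ diagonalOp lam f = 0)
    {β : Fin n →₀ ℕ} {i : Fin n} {f : Polynomial ℝ} (hf0 : f ≠ 0)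
    (hf : ∀ k, fallingEval f k = lam (β + Finsupp.single i k : Fin n →₀ ℕ)) :
    HasOnlyRealNonposZeros f := by
  refine hasOnlyRealNonposZeros_of_eulerOp hf0 fun q hq => ?_
  have hst : IsRealStable (embedVar β i q) := by
    refine ⟨fun z hz => ?_, hasRealCoeffs_map _⟩
    rw [eval_embedVar]
    exact mul_ne_zero (eval_monomial_ne_zero β hz) (hq _ (hz i))
  have h1 := hT _ hst
  rw [diagonalOp_embedVar hf] at h1
  rcases h1 with h1 | h1
  · left
    intro x hx h0
    refine h1.1 (fun _ => x) (fun _ => hx) ?_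
    rw [eval_embedVar, h0, mul_zero]
  · right
    refine Polynomial.map_injective Complex.ofRealHom Complex.ofReal_injective ?_
    rw [Polynomial.map_zero]
    have hinf : {x : ℂ | x ≠ 0}.Infinite := (Set.finite_singleton (0 : ℂ)).infinite_compl
    refine Polynomial.eq_zero_of_infinite_isRoot _ (hinf.mono fun x hx => ?_)
    have h2 := congrArg (eval fun _ => x) h1
    rw [eval_embedVar, map_zero, eval_monomial, one_mul] at h2
    have h3 := (mul_eq_zero.1 h2).resolve_left
      (Finset.prod_ne_zero_iff.2 fun _ _ => pow_ne_zero _ hx)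
    exact (Polynomial.eval_map _ _).trans h3

/-- The polynomial with `fallingEval` equal to the eigenvalues along the line through `b` in the
direction of the coordinate `i`. -/
noncomputable def sectionPoly {n : ℕ} (S : Finset (Fin n ⊕ Fin n →₀ ℕ))
    (g : (Fin n ⊕ Fin n →₀ ℕ) → ℝ) (b : Fin n → ℕ) (i : Fin n) : Polynomial ℝ :=
  ∑ m ∈ S, Polynomial.monomial (m (Sum.inr i))
    (g m * ∏ j ∈ Finset.univ.erase i, ((b j).descFactorial (m (Sum.inr j)) : ℝ))

lemma fallingEval_sectionPoly {n : ℕ} {S : Finset (Fin n ⊕ Fin n →₀ ℕ)}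
    {g : (Fin n ⊕ Fin n →₀ ℕ) → ℝ} {lam : (Fin n → ℕ) → ℝ}
    (hlam : ∀ α : Fin n → ℕ,
      lam α = ∑ m ∈ S, g m * ∏ i, ((α i).descFactorial (m (Sum.inr i)) : ℝ))
    (b : Fin n → ℕ) (i : Fin n) (k : ℕ) :
    fallingEval (sectionPoly S g b i) k = lam (Function.update b i k) := by
  rw [sectionPoly, fallingEval_sum, hlam]
  refine Finset.sum_congr rfl fun m _ => ?_
  rw [fallingEval_monomial, ← Finset.prod_erase_mul _ _ (Finset.mem_univ i),
    Function.update_self, mul_assoc]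
  congr 2
  refine Finset.prod_congr rfl fun j hj => ?_
  rw [Function.update_of_ne (Finset.ne_of_mem_erase hj)]

lemma exists_productSymbol_of_preserver {n : ℕ} (hn : 1 ≤ n) {lam : (Fin n → ℕ) → ℝ}
    (h : IsFiniteOrderRealStabilityPreserver (diagonalOp lam)) :
    ∃ f : Fin n → Polynomial ℝ, (∀ i, HasOnlyRealNonposZeros (f i)) ∧
      HasSymbol (diagonalOp lam) (productSymbol f) := by
  obtain ⟨hreal, hne, hT⟩ := h
  obtain ⟨S, g, hlam⟩ := exists_eigenvalue_expansion hreal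
  set P := eigenvaluePoly S g with hPdef
  have hP : ∀ α, eval (fun i => (α i : ℝ)) P = lam α := fun α => by
    rw [hPdef, eval_natCast_eigenvaluePoly, hlam]
  obtain ⟨b, hb⟩ : ∃ b, lam b ≠ 0 := by
    by_contra! h0
    refine hne ((basisMonomials (Fin n) ℂ).ext fun α => ?_)
    rw [coe_basisMonomials, diagonalOp_monomial, h0]
    simp
  have hP0 : P ≠ 0 := by
    intro h0
    have := hP b
    rw [h0, map_zero] at this
    exact hb this.symm
  have hupd : ∀ (i : Fin n) (k : ℕ),
      (Function.update (fun j => (b j : ℝ)) i k) = fun j => (Function.update b i k j : ℝ) := by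
    intro i k
    ext j
    by_cases hj : j = i
    · subst hj; simp
    · simp [hj]
  have hprod : ∀ α, lam α * lam b ^ n = lam b * ∏ i, lam (Function.update b i (α i)) := by
    intro α
    have h1 := eval_mul_pow_eq_prod hP0 (fun i j hij => rankOne_eigenvaluePoly hT hP hij)
      (fun j => (b j : ℝ)) (fun j => (α j : ℝ))
    simpa only [hupd, hP] using h1
  -- the constants `c i` distribute the factor `lam b * (lam b)⁻¹ ^ n`
  set c : Fin n → ℝ := fun i => (lam b)⁻¹ * if i = ⟨0, hn⟩ then lam b else 1 with hc
  have hc0 : ∀ i, c i ≠ 0 := by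
    intro i
    refine mul_ne_zero (inv_ne_zero hb) ?_
    split_ifs
    exacts [hb, one_ne_zero]
  have hcprod : ∏ i, c i = (lam b)⁻¹ ^ n * lam b := by
    simp only [hc, Finset.prod_mul_distrib, Finset.prod_const, Finset.card_univ, Fintype.card_fin,
      Finset.prod_ite_eq', Finset.mem_univ, if_true]
  have hsec0 : ∀ i, sectionPoly S g b i ≠ 0 := by
    intro i h0
    have h1 := fallingEval_sectionPoly hlam b i (b i)
    rw [h0, Function.update_eq_self] at h1
    exact hb (by rw [← h1]; simp [fallingEval])
  refine ⟨fun i => Polynomial.C (c i) * sectionPoly S g b i, fun i => ?_, ?_⟩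
  · have h1 : HasOnlyRealNonposZeros (sectionPoly S g b i) := by
      refine hasOnlyRealNonposZeros_of_preserver hT
        (β := (Finsupp.equivFunOnFinite.symm b).erase i) (i := i) (hsec0 i) fun k => ?_
      rw [fallingEval_sectionPoly hlam]
      congr 1
      ext j
      by_cases hj : j = i
      · subst hj; simp
      · simp [hj]
    refine ⟨mul_ne_zero (Polynomial.C_ne_zero.2 (hc0 i)) h1.1, fun x hx => h1.2 x ?_⟩
    rw [map_mul, Polynomial.aeval_C] at hx
    refine (mul_eq_zero.1 hx).resolve_left ?_
    simpa using hc0 i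
  · rw [hasSymbol_productSymbol_iff]
    intro α
    simp only [fallingEval_C_mul, fallingEval_sectionPoly hlam, Finset.prod_mul_distrib, hcprod]
    have h1 : lam b ^ n ≠ 0 := pow_ne_zero _ hb
    rw [mul_assoc, ← hprod, inv_pow]
    field_simp

end

theorem theorem1p8 (n : ℕ) (hn : 1 ≤ n) (lam : (Fin n → ℕ) → ℝ) :
    IsFiniteOrderRealStabilityPreserver (diagonalOp lam) ↔
      ∃ f : Fin n → Polynomial ℝ, (∀ i, HasOnlyRealNonposZeros (f i)) ∧
        HasSymbol (diagonalOp lam) (productSymbol f) :=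
  ⟨fun h => exists_productSymbol_of_preserver hn h,
    fun ⟨_, hf, h⟩ => isFiniteOrderRealStabilityPreserver_of_productSymbol hf h⟩
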